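/- Composition is written in diagrammatic order, and all categories are small (in a fixed but arbitrary universe). **Restriction categories.** A restriction category is a category $\mathbb X$ with an assignment $(f\colon A\to B)\mapsto(\bar f\colon A\to A)$ such that $\bar f f=f$; $\bar f\bar g=\bar g\bar f$ and $\bar g\bar f=\overline{\bar g f}$ for $f\colon A\to B$, $g\colon A\to C$; and $f\bar g=\overline{fg}f$ for $f\colon A\to B$, $g\colon B\to C$. A morphism $f$ is total if $\bar f=\mathrm{id}$. A restriction functor is a functor with $F\bar f=\overline{Ff}$. A restriction natural transformation $F\Rightarrow G$ is a family of total morphisms $\varphi_A\colon FA\to GA$ with $(Ff)\varphi_B=(F\bar f)\varphi_A(Gf)$ for all $f\colon A\to B$; it is called total if it is natural. These data form a 2-category $\mathsf{RCat}_{\mathsf{lax}}$; keeping only the total natural transformations as 2-cells gives $\mathsf{RCat}$. **Local categories.** A local category is a category $\mathbb C$ in which every object $M$ has an assigned object $\mathsf LM$ and a monomorphism $\eta_M\colon M\to \mathsf LM$ such that $\mathsf{LL}M=\mathsf LM$ and $\eta_{\mathsf LM}=\mathrm{id}$, and such that for all $M$ and $f\colon N\to\mathsf LM$ there is a pullback $m\colon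 P\to N$ of $\eta_M$ along $f$ with $\mathsf LP=\mathsf LN$ and $m\eta_N=\eta_P$. An object $M$ is total if $\mathsf LM=M$ and $\eta_M=\mathrm{id}_M$. A local functor is a functor with $F\mathsf LM=\mathsf L'FM$, $F\eta_M=\eta'_{FM}$, preserving all pullbacks of maximal inclusions $\eta_M$ along arbitrary morphisms $N\to\mathsf LM$. A local natural transformation is a natural transformation $\varphi\colon F\Rightarrow G$; it is called total if its naturality square at $\eta_M$ is a pullback for every $M$. These data form a 2-category $\mathsf{LCat}_{\mathsf{lax}}$; keeping only the total natural transformations as 2-cells gives $\mathsf{LCat}$. **The 2-functor $\mathbf L_{\mathsf{lax}}\colon \mathsf{RCat}_{\mathsf{lax}}\to\mathsf{LCat}_{\mathsf{lax}}$.** $\mathbf L[\mathbb X]$ is the category of total morphisms of the split completion of $\mathbb X$: objects are pairs $(A,a)$ with $a=\bar a\colon A\to A$, morphisms $(A,a)\to(B,b)$ are morphisms $f\colon A\to B$ with $\bar f=a$ and $fb=f$, composition is that of $\mathbb X$, the identity of $(A,a)$ is $a$, $\mathsf L(A,a)=(A,\mathrm{id}_A)$ and $\eta_{(A,a)}=a$.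 Moreover $\mathbf L[F](A,a)=(FA,Fa)$, $\mathbf L[F](f)=Ff$ and $\mathbf L[\varphi]_{(A,a)}=(Fa)\varphi_A$. **The 2-functor $\mathbf R_{\mathsf{lax}}\colon \mathsf{LCat}_{\mathsf{lax}}\to\mathsf{RCat}_{\mathsf{lax}}$.** The objects of $\mathbf R[\mathbb C]$ are the total objects of $\mathbb C$; a morphism $M\to N$ is an isomorphism class of pairs $(U,f)$ with $\mathsf LU=M$ and $f\colon U\to N$, where $(U,f)\cong(V,g)$ if there is an isomorphism $\varphi\colon U\to V$ with $\varphi\eta_V=\eta_U$ and $\varphi g=f$; composition is composition of the spans $M\xleftarrow{\eta_U}U\xrightarrow{f}N$ by pullback, and $\overline{(U,f)}=(U,\eta_U)$. Moreover $\mathbf R[F](M)=FM$, $\mathbf R[F](U,f)=(FU,Ff)$ and $\mathbf R[\varphi]_M=(FM,\varphi_M)$. **Theorem.** $\mathbf L_{\mathsf{lax}}$ and $\mathbf R_{\mathsf{lax}}$ are (strict) 2-functors that form a 2-equivalence $\mathsf{RCat}_{\mathsf{lax}}\simeq\mathsf{LCat}_{\mathsf{lax}}$ in the following sense: there are strictly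 2-natural transformations with components $\mathbb C\to\mathbf L[\mathbf R[\mathbb C]]$ (unit) and $\mathbf R[\mathbf L[\mathbb X]]\to\mathbb X$ (counit) that satisfy the triangle identities, so that they form a 2-adjunction $\mathbf R_{\mathsf{lax}}\dashv\mathbf L_{\mathsf{lax}}$, and all their components are internal equivalences. More precisely, every component of the counit is an isomorphism of restriction categories, and the component $\mathbb C\to\mathbf L[\mathbf R[\mathbb C]]$ of the unit is an equivalence of local categories for every $\mathbb C$, and is an isomorphism of local categories if and only if $U=V$ whenever $\mathsf LU=\mathsf LV$ and there is an isomorphism $\varphi\colon U\to V$ with $\varphi\eta_V=\eta_U$. Moreover, this 2-equivalence restricts to total natural transformations: $\mathbf L_{\mathsf{lax}}$ and $\mathbf R_{\mathsf{lax}}$ send total natural transformations to total natural transformations, and the resulting 2-functors $\mathbf L\colon\mathsf{RCat}\to\mathsf{LCat}$ and $\mathbf R\colon\mathsf{LCat}\to\mathsf{RCat}$ form, with the same components of unit and counit, a 2-equivalence $\mathsf{RCat}\simeq\mathsf{LCat}$ in the same sense. -/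

import Mathlib

open CategoryTheory

universe v u w₁ w₂ v₁ v₂ u₁ u₂

noncomputable section

namespace Partiality

/-! ### Restriction categories -/

/-- A restriction structure on a category: an assignment `f ↦ res f` satisfying the four
restriction identities (composition is written in diagrammatic order). -/
class RestrictionStructure (X : Type u) [Category.{v} X] where
  res : ∀ {A B : X}, (A ⟶ B) → (A ⟶ A)
  res_comp_self : ∀ {A B : X} (f : A ⟶ B), res f ≫ f = f
  res_comm : ∀ {A B C : X} (f : A ⟶ B) (g : A ⟶ C), res f ≫ res g = res g ≫ res f
  res_res_comp : ∀ {A B C : X} (f : A ⟶ B) (g : A ⟶ C), res g ≫ res f = res (res g ≫ f)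
  comp_res : ∀ {A B C : X} (f : A ⟶ B) (g : B ⟶ C), f ≫ res g = res (f ≫ g) ≫ f

open RestrictionStructure

section

variable {X : Type u} [Category.{v} X] [RestrictionStructure X]

theorem res_id (A : X) : res (𝟙 A) = 𝟙 A := by
  have := res_comp_self (𝟙 A)
  rwa [Category.comp_id] at this

theorem res_idem {A B : X} (f : A ⟶ B) : res f ≫ res f = res f := by
  rw [res_res_comp, res_comp_self]

theorem res_res {A B : X} (f : A ⟶ B) : res (res f) = res f := by
  have h := res_res_comp (𝟙 A) f
  rw [res_id, Category.comp_id] at h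
  exact h.symm

theorem res_comp_res {A B C : X} (f : A ⟶ B) (g : B ⟶ C) : res (f ≫ res g) = res (f ≫ g) := by
  rw [comp_res, ← res_res_comp, res_comm, res_res_comp, ← Category.assoc, res_comp_self]

theorem res_comp_total {A B C : X} (f : A ⟶ B) (g : B ⟶ C) (hg : res g = 𝟙 B) :
    res (f ≫ g) = res f := by
  rw [← res_comp_res, hg, Category.comp_id]

theorem res_of_res_eq {A B C : X} {f : A ⟶ B} {g : B ⟶ C} {b : B ⟶ B} (hg : res g = b)
    (hf : f ≫ b = f) : res (f ≫ g) = res f := by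
  rw [← res_comp_res, hg, hf]

end

/-- A restriction functor: a functor preserving restriction idempotents. -/
structure RestrictionFunctor (X Y : Type u) [Category.{v} X] [RestrictionStructure X]
    [Category.{v} Y] [RestrictionStructure Y] extends X ⥤ Y where
  map_res : ∀ {A B : X} (f : A ⟶ B), map (res f) = res (map f)

section

variable {X Y Z : Type u} [Category.{v} X] [RestrictionStructure X]
  [Category.{v} Y] [RestrictionStructure Y] [Category.{v} Z] [RestrictionStructure Z]

/-- A restriction natural transformation: a family of total morphisms such that
`F f ≫ φ B = F (res f) ≫ φ A ≫ G f` for every `f : A ⟶ B`. -/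
@[ext]
structure RestrictionTrans (F G : RestrictionFunctor X Y) where
  app : ∀ A : X, F.obj A ⟶ G.obj A
  total : ∀ A : X, res (app A) = 𝟙 (F.obj A)
  lax_naturality : ∀ {A B : X} (f : A ⟶ B),
    F.map f ≫ app B = F.map (res f) ≫ app A ≫ G.map f

/-- A restriction natural transformation is a total natural transformation when it is natural.
(Conversely, a natural family of total morphisms always is a restriction natural
transformation, see `RestrictionTrans.ofNatural`.) -/
def RestrictionTrans.IsNatural {F G : RestrictionFunctor X Y} (φ : RestrictionTrans F G) : Prop :=
  ∀ {A B : X} (f : A ⟶ B), F.map f ≫ φ.app B = φ.app A ≫ G.map f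

def RestrictionTrans.ofNatural {F G : RestrictionFunctor X Y} (app : ∀ A : X, F.obj A ⟶ G.obj A)
    (total : ∀ A : X, res (app A) = 𝟙 (F.obj A))
    (naturality : ∀ {A B : X} (f : A ⟶ B), F.map f ≫ app B = app A ≫ G.map f) :
    RestrictionTrans F G where
  app := app
  total := total
  lax_naturality f := by
    rw [← Category.assoc, naturality (res f), Category.assoc, ← G.map_comp, res_comp_self,
      naturality f]

instance : Category (RestrictionFunctor X Y) where
  Hom F G := RestrictionTrans F G
  id F :=
    { app := fun A => 𝟙 _
      total := fun A => res_id _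
      lax_naturality := fun f => by
        rw [Category.comp_id, Category.id_comp, ← F.map_comp, res_comp_self] }
  comp {F G H} φ ψ :=
    { app := fun A => φ.app A ≫ ψ.app A
      total := fun A => by rw [res_comp_total _ _ (ψ.total A), φ.total]
      lax_naturality := fun {A B} f => by
        have h : F.map (res f) ≫ φ.app A = F.map (res f) ≫ φ.app A ≫ G.map (res f) := by
          have := φ.lax_naturality (res f)
          rwa [res_res] at this
        rw [← Category.assoc, φ.lax_naturality f, Category.assoc, Category.assoc,
          ψ.lax_naturality f, ← Category.assoc, ← Category.assoc, Category.assoc (F.map _),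
          ← h]
        simp only [Category.assoc] }
  id_comp φ := RestrictionTrans.ext (funext fun A => Category.id_comp _)
  comp_id φ := RestrictionTrans.ext (funext fun A => Category.comp_id _)
  assoc φ ψ χ := RestrictionTrans.ext (funext fun A => Category.assoc _ _ _)

@[ext]
theorem RestrictionTrans.hom_ext {F G : RestrictionFunctor X Y} {φ ψ : F ⟶ G}
    (h : ∀ A, RestrictionTrans.app φ A = RestrictionTrans.app ψ A) : φ = ψ :=
  RestrictionTrans.ext (funext h)

@[simp]
theorem RestrictionTrans.id_app (F : RestrictionFunctor X Y) (A : X) :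
    RestrictionTrans.app (𝟙 F) A = 𝟙 (F.obj A) := rfl

@[simp]
theorem RestrictionTrans.comp_app {F G H : RestrictionFunctor X Y} (φ : F ⟶ G) (ψ : G ⟶ H)
    (A : X) : RestrictionTrans.app (φ ≫ ψ) A =
      RestrictionTrans.app φ A ≫ RestrictionTrans.app ψ A := rfl

theorem RestrictionFunctor.ext_functor {F G : RestrictionFunctor X Y}
    (h : F.toFunctor = G.toFunctor) : F = G := by
  cases F; cases G; cases h; rfl

theorem RestrictionTrans.eqToHom_app {F G : RestrictionFunctor X Y} (h : F = G) (A : X) :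
    RestrictionTrans.app (eqToHom h) A = eqToHom (by rw [h]) := by
  subst h; rfl

def RestrictionFunctor.id (X : Type u) [Category.{v} X] [RestrictionStructure X] :
    RestrictionFunctor X X where
  toFunctor := 𝟭 X
  map_res _ := rfl

def RestrictionFunctor.comp (F : RestrictionFunctor X Y) (G : RestrictionFunctor Y Z) :
    RestrictionFunctor X Z where
  toFunctor := F.toFunctor ⋙ G.toFunctor
  map_res f := by
    simp only [Functor.comp_map, F.map_res, G.map_res]

def RestrictionTrans.whiskerLeft (F : RestrictionFunctor X Y) {G H : RestrictionFunctor Y Z}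
    (φ : G ⟶ H) : F.comp G ⟶ F.comp H :=
  RestrictionTrans.mk (F := F.comp G) (G := F.comp H) (fun A => φ.app (F.obj A))
    (fun A => φ.total _)
    (fun f => by
      have := φ.lax_naturality (F.map f)
      rw [← F.map_res] at this
      exact this)

def RestrictionTrans.whiskerRight {F G : RestrictionFunctor X Y} (φ : F ⟶ G)
    (H : RestrictionFunctor Y Z) : F.comp H ⟶ G.comp H :=
  RestrictionTrans.mk (F := F.comp H) (G := G.comp H) (fun A => H.map (φ.app A))
    (fun A => ((H.map_res _).symm.trans (congrArg (fun t => H.map t) (φ.total A))).trans (H.map_id _))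
    (fun f => by
      have := congrArg (fun t => H.map t) (φ.lax_naturality f)
      simp only [H.map_comp] at this
      exact this)

end

/-- (Small) restriction categories, as the objects of the 2-category with restriction functors
and restriction natural transformations. -/
structure RCatLax where
  carrier : Type u
  [cat : SmallCategory.{u} carrier]
  [str : RestrictionStructure carrier]

attribute [instance] RCatLax.cat RCatLax.str

instance : CategoryStruct RCatLax.{u} where
  Hom X Y := RestrictionFunctor X.carrier Y.carrier
  id X := RestrictionFunctor.id X.carrier
  comp F G := RestrictionFunctor.comp F G

instance (X Y : RCatLax.{u}) : Category (X ⟶ Y) :=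
  inferInstanceAs (Category (RestrictionFunctor X.carrier Y.carrier))

instance : Bicategory RCatLax.{u} where
  whiskerLeft F _ _ φ := RestrictionTrans.whiskerLeft F φ
  whiskerRight φ H := RestrictionTrans.whiskerRight φ H
  associator F G H := eqToIso rfl
  leftUnitor F := eqToIso rfl
  rightUnitor F := eqToIso rfl
  whiskerLeft_id F G := rfl
  whiskerLeft_comp F _ _ _ φ ψ := rfl
  id_whiskerLeft φ := by
    apply RestrictionTrans.hom_ext; intro A
    exact (Category.id_comp _).symm.trans (congrArg _ (Category.comp_id _).symm)
  comp_whiskerLeft F G _ _ φ := by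
    apply RestrictionTrans.hom_ext; intro A
    exact (Category.id_comp _).symm.trans (congrArg _ (Category.comp_id _).symm)
  id_whiskerRight F G := by
    apply RestrictionTrans.hom_ext; intro A
    exact G.map_id _
  comp_whiskerRight φ ψ H := by
    apply RestrictionTrans.hom_ext; intro A
    exact H.map_comp _ _
  whiskerRight_id φ := by
    apply RestrictionTrans.hom_ext; intro A
    exact (Category.id_comp _).symm.trans (congrArg _ (Category.comp_id _).symm)
  whiskerRight_comp φ G H := by
    apply RestrictionTrans.hom_ext; intro A
    exact (Category.id_comp _).symm.trans (congrArg _ (Category.comp_id _).symm)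
  whisker_assoc F _ _ φ H := by
    apply RestrictionTrans.hom_ext; intro A
    exact (Category.id_comp _).symm.trans (congrArg _ (Category.comp_id _).symm)
  whisker_exchange {_ _ _ F G H K} φ ψ := by
    apply RestrictionTrans.hom_ext; intro A
    have h := RestrictionTrans.lax_naturality ψ (RestrictionTrans.app φ A)
    rw [RestrictionTrans.total φ A, H.map_id, Category.id_comp] at h
    exact h.symm
  pentagon F G H K := by
    apply RestrictionTrans.hom_ext; intro A
    exact congrArg₂ (· ≫ ·) (K.map_id _) (Category.id_comp _)
  triangle F G := by
    apply RestrictionTrans.hom_ext; intro A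
    exact (Category.id_comp _).trans (G.map_id _).symm

instance : Bicategory.Strict RCatLax.{u} where
  id_comp _ := rfl
  comp_id _ := rfl
  assoc _ _ _ := rfl
  leftUnitor_eqToIso _ := rfl
  rightUnitor_eqToIso _ := rfl
  associator_eqToIso _ _ _ := rfl

/-! ### Local categories -/

/-- A local structure on a category: every object `M` has an enlargement `L M` and a maximal
inclusion `η M : M ⟶ L M`. Equalities between objects are expressed by `eqToHom`. -/
class LocalStructure (C : Type u) [Category.{v} C] where
  L : C → C
  η : ∀ M : C, M ⟶ L M
  L_L : ∀ M : C, L (L M) = L M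
  η_L : ∀ M : C, η (L M) = eqToHom (L_L M).symm
  mono_η : ∀ M : C, Mono (η M)
  exists_pullback : ∀ {M N : C} (f : N ⟶ L M),
    ∃ (P : C) (p : P ⟶ M) (m : P ⟶ N) (h : L P = L N),
      IsPullback p m (η M) f ∧ m ≫ η N = η P ≫ eqToHom h

open LocalStructure

attribute [instance] LocalStructure.mono_η

/-- A total object: `L M = M` and `η M` is the identity. -/
def IsTotalObj {C : Type u} [Category.{v} C] [LocalStructure C] (M : C) : Prop :=
  ∃ h : L M = M, η M = eqToHom h.symm

/-- A local functor: it strictly preserves enlargements and maximal inclusions, and it preserves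
all pullbacks of maximal inclusions. -/
structure LocalFunctor (C D : Type u) [Category.{v} C] [LocalStructure C]
    [Category.{v} D] [LocalStructure D] extends C ⥤ D where
  obj_L : ∀ M : C, obj (L M) = L (obj M)
  map_η : ∀ M : C, map (η M) = η (obj M) ≫ eqToHom (obj_L M).symm
  map_pullback : ∀ {P M N : C} {p : P ⟶ M} {m : P ⟶ N} {f : N ⟶ L M},
    IsPullback p m (η M) f → IsPullback (map p) (map m) (map (η M)) (map f)

section

variable {C D E : Type u} [Category.{v} C] [LocalStructure C]
  [Category.{v} D] [LocalStructure D] [Category.{v} E] [LocalStructure E]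

/-- A local natural transformation: a natural transformation of the underlying functors. -/
@[ext]
structure LocalTrans (F G : LocalFunctor C D) where
  app : ∀ M : C, F.obj M ⟶ G.obj M
  naturality : ∀ {M N : C} (f : M ⟶ N), F.map f ≫ app N = app M ≫ G.map f

/-- A local natural transformation is total when its naturality squares at the maximal inclusions
are pullbacks. -/
def LocalTrans.IsTotal {F G : LocalFunctor C D} (φ : LocalTrans F G) : Prop :=
  ∀ M : C, IsPullback (φ.app M) (F.map (η M)) (G.map (η M)) (φ.app (L M))

instance : Category (LocalFunctor C D) where
  Hom F G := LocalTrans F G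
  id F :=
    { app := fun M => 𝟙 _
      naturality := fun f => (Category.comp_id _).trans (Category.id_comp _).symm }
  comp {F G H} φ ψ :=
    { app := fun M => φ.app M ≫ ψ.app M
      naturality := fun f => by
        rw [← Category.assoc, φ.naturality, Category.assoc, ψ.naturality, Category.assoc] }
  id_comp φ := LocalTrans.ext (funext fun A => Category.id_comp _)
  comp_id φ := LocalTrans.ext (funext fun A => Category.comp_id _)
  assoc φ ψ χ := LocalTrans.ext (funext fun A => Category.assoc _ _ _)

@[ext]
theorem LocalTrans.hom_ext {F G : LocalFunctor C D} {φ ψ : F ⟶ G}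
    (h : ∀ M, LocalTrans.app φ M = LocalTrans.app ψ M) : φ = ψ :=
  LocalTrans.ext (funext h)

@[simp]
theorem LocalTrans.id_app (F : LocalFunctor C D) (M : C) :
    LocalTrans.app (𝟙 F) M = 𝟙 (F.obj M) := rfl

@[simp]
theorem LocalTrans.comp_app {F G H : LocalFunctor C D} (φ : F ⟶ G) (ψ : G ⟶ H)
    (M : C) : LocalTrans.app (φ ≫ ψ) M = LocalTrans.app φ M ≫ LocalTrans.app ψ M := rfl

theorem LocalFunctor.ext_functor {F G : LocalFunctor C D}
    (h : F.toFunctor = G.toFunctor) : F = G := by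
  cases F; cases G; cases h; rfl

theorem LocalTrans.eqToHom_app {F G : LocalFunctor C D} (h : F = G) (M : C) :
    LocalTrans.app (eqToHom h) M = eqToHom (by rw [h]) := by
  subst h; rfl

def LocalFunctor.id (C : Type u) [Category.{v} C] [LocalStructure C] : LocalFunctor C C where
  toFunctor := 𝟭 C
  obj_L _ := rfl
  map_η _ := (Category.comp_id _).symm
  map_pullback h := h

theorem LocalFunctor.map_pullback_eqToHom (F : LocalFunctor C D) {P M N K : C} {p : P ⟶ M}
    {m : P ⟶ N} {f : N ⟶ K} (h : L M = K) (sq : IsPullback p m (η M ≫ eqToHom h) f) :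
    IsPullback (F.map p) (F.map m) (F.map (η M ≫ eqToHom h)) (F.map f) := by
  subst h
  simp only [eqToHom_refl, Category.comp_id] at sq ⊢
  exact F.map_pullback sq

def LocalFunctor.comp (F : LocalFunctor C D) (G : LocalFunctor D E) : LocalFunctor C E where
  toFunctor := F.toFunctor ⋙ G.toFunctor
  obj_L M := (congrArg (fun t => G.obj t) (F.obj_L M)).trans (G.obj_L _)
  map_η M := by
    simp only [Functor.comp_map, F.map_η, Functor.map_comp, G.map_η, eqToHom_map, Category.assoc,
      eqToHom_trans]
    rfl
  map_pullback {P M N p m f} sq := by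
    have h := F.map_pullback sq
    rw [F.map_η] at h
    have h' := G.map_pullback_eqToHom _ h
    rw [← F.map_η] at h'
    exact h'

def LocalTrans.whiskerLeft (F : LocalFunctor C D) {G H : LocalFunctor D E}
    (φ : G ⟶ H) : F.comp G ⟶ F.comp H :=
  LocalTrans.mk (F := F.comp G) (G := F.comp H) (fun M => φ.app (F.obj M))
    (fun f => φ.naturality (F.map f))

def LocalTrans.whiskerRight {F G : LocalFunctor C D} (φ : F ⟶ G)
    (H : LocalFunctor D E) : F.comp H ⟶ G.comp H :=
  LocalTrans.mk (F := F.comp H) (G := G.comp H) (fun M => H.map (φ.app M))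
    (fun f => by
      have := congrArg (fun t => H.map t) (φ.naturality f)
      simp only [H.map_comp] at this
      exact this)

theorem LocalTrans.app_congr {F G : LocalFunctor C D} (φ : LocalTrans F G) {M N : C} (h : M = N) :
    φ.app M ≫ eqToHom (congrArg (fun t => G.obj t) h) =
      eqToHom (congrArg (fun t => F.obj t) h) ≫ φ.app N := by
  subst h
  simp

theorem LocalTrans.isTotal_of_isIso {F G : LocalFunctor C D} (φ : LocalTrans F G)
    (h : ∀ M, IsIso (φ.app M)) : φ.IsTotal := fun M => by
  have := h M
  have := h (L M)
  exact IsPullback.of_horiz_isIso ⟨(φ.naturality _).symm⟩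

theorem LocalTrans.isTotal_comp {F G H : LocalFunctor C D} (φ : F ⟶ G) (ψ : G ⟶ H)
    (hφ : LocalTrans.IsTotal φ) (hψ : LocalTrans.IsTotal ψ) :
    LocalTrans.IsTotal (φ ≫ ψ) := fun M =>
  (hφ M).paste_horiz (hψ M)

theorem LocalTrans.isTotal_whiskerLeft (F : LocalFunctor C D) {G H : LocalFunctor D E}
    (φ : G ⟶ H) (hφ : LocalTrans.IsTotal φ) :
    LocalTrans.IsTotal (LocalTrans.whiskerLeft F φ) := fun M => by
  have h := hφ (F.obj M)
  refine h.of_iso (Iso.refl _) (Iso.refl _)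
    (eqToIso (congrArg (fun t => G.obj t) (F.obj_L M).symm))
    (eqToIso (congrArg (fun t => H.obj t) (F.obj_L M).symm)) ?_ ?_ ?_ ?_
  · exact (Category.comp_id _).trans (Category.id_comp _).symm
  · change G.map (η (F.obj M)) ≫ _ = 𝟙 _ ≫ G.map (F.map (η M))
    rw [F.map_η, Functor.map_comp, eqToHom_map, Category.id_comp]
    rfl
  · change H.map (η (F.obj M)) ≫ _ = 𝟙 _ ≫ H.map (F.map (η M))
    rw [F.map_η, Functor.map_comp, eqToHom_map, Category.id_comp]
    rfl
  · exact LocalTrans.app_congr φ (F.obj_L M).symm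

theorem LocalTrans.isTotal_whiskerRight {F G : LocalFunctor C D} (φ : F ⟶ G)
    (H : LocalFunctor D E) (hφ : LocalTrans.IsTotal φ) :
    LocalTrans.IsTotal (LocalTrans.whiskerRight φ H) := fun M => by
  have h := hφ M
  rw [G.map_η] at h
  have h' := H.map_pullback_eqToHom _ h
  rw [← G.map_η] at h'
  exact h'

end

/-- (Small) local categories, as the objects of the 2-category with local functors and local
natural transformations. -/
structure LCatLax where
  carrier : Type u
  [cat : SmallCategory.{u} carrier]
  [str : LocalStructure carrier]

attribute [instance] LCatLax.cat LCatLax.str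

instance : CategoryStruct LCatLax.{u} where
  Hom X Y := LocalFunctor X.carrier Y.carrier
  id X := LocalFunctor.id X.carrier
  comp F G := LocalFunctor.comp F G

instance (X Y : LCatLax.{u}) : Category (X ⟶ Y) :=
  inferInstanceAs (Category (LocalFunctor X.carrier Y.carrier))

instance : Bicategory LCatLax.{u} where
  whiskerLeft F _ _ φ := LocalTrans.whiskerLeft F φ
  whiskerRight φ H := LocalTrans.whiskerRight φ H
  associator F G H := eqToIso rfl
  leftUnitor F := eqToIso rfl
  rightUnitor F := eqToIso rfl
  whiskerLeft_id F G := rfl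
  whiskerLeft_comp F _ _ _ φ ψ := rfl
  id_whiskerLeft φ := by
    apply LocalTrans.hom_ext; intro A
    exact (Category.id_comp _).symm.trans (congrArg _ (Category.comp_id _).symm)
  comp_whiskerLeft F G _ _ φ := by
    apply LocalTrans.hom_ext; intro A
    exact (Category.id_comp _).symm.trans (congrArg _ (Category.comp_id _).symm)
  id_whiskerRight F G := by
    apply LocalTrans.hom_ext; intro A
    exact G.map_id _
  comp_whiskerRight φ ψ H := by
    apply LocalTrans.hom_ext; intro A
    exact H.map_comp _ _
  whiskerRight_id φ := by
    apply LocalTrans.hom_ext; intro A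
    exact (Category.id_comp _).symm.trans (congrArg _ (Category.comp_id _).symm)
  whiskerRight_comp φ G H := by
    apply LocalTrans.hom_ext; intro A
    exact (Category.id_comp _).symm.trans (congrArg _ (Category.comp_id _).symm)
  whisker_assoc F _ _ φ H := by
    apply LocalTrans.hom_ext; intro A
    exact (Category.id_comp _).symm.trans (congrArg _ (Category.comp_id _).symm)
  whisker_exchange {_ _ _ F G H K} φ ψ := by
    apply LocalTrans.hom_ext; intro A
    exact (LocalTrans.naturality ψ (LocalTrans.app φ A)).symm
  pentagon F G H K := by
    apply LocalTrans.hom_ext; intro A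
    exact congrArg₂ (· ≫ ·) (K.map_id _) (Category.id_comp _)
  triangle F G := by
    apply LocalTrans.hom_ext; intro A
    exact (Category.id_comp _).trans (G.map_id _).symm

instance : Bicategory.Strict LCatLax.{u} where
  id_comp _ := rfl
  comp_id _ := rfl
  assoc _ _ _ := rfl
  leftUnitor_eqToIso _ := rfl
  rightUnitor_eqToIso _ := rfl
  associator_eqToIso _ _ _ := rfl

/-! ### 2-categorical notions -/

open Bicategory

/-- A class of 2-cells of a strict 2-category that is closed under identities, vertical composition
and whiskering. -/
structure TwoCellClass (B : Type u₁) [Bicategory.{w₁, v₁} B] [Bicategory.Strict B] where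
  mem : ∀ {a b : B} {f g : a ⟶ b}, (f ⟶ g) → Prop
  id_mem : ∀ {a b : B} (f : a ⟶ b), mem (𝟙 f)
  comp_mem : ∀ {a b : B} {f g h : a ⟶ b} (α : f ⟶ g) (β : g ⟶ h),
    mem α → mem β → mem (α ≫ β)
  whiskerLeft_mem : ∀ {a b c : B} (f : a ⟶ b) {g h : b ⟶ c} (α : g ⟶ h),
    mem α → mem (f ◁ α)
  whiskerRight_mem : ∀ {a b c : B} {f g : a ⟶ b} (α : f ⟶ g) (h : b ⟶ c),
    mem α → mem (α ▷ h)

namespace TwoCellClass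

variable {B : Type u₁} [Bicategory.{w₁, v₁} B] [Bicategory.Strict B] (W : TwoCellClass B)

theorem eqToHom_mem {a b : B} {f g : a ⟶ b} (h : f = g) : W.mem (eqToHom h) := by
  subst h; exact W.id_mem _

/-- The 2-category with the same objects and 1-cells as `B`, but only with the 2-cells of
the class `W`. -/
structure Sub (W : TwoCellClass B) where
  obj : B

/-- 1-cells of `W.Sub`. -/
@[ext]
structure Hom₁ (a b : W.Sub) where
  hom : a.obj ⟶ b.obj

instance : CategoryStruct W.Sub where
  Hom a b := W.Hom₁ a b
  id a := ⟨𝟙 a.obj⟩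
  comp f g := ⟨f.hom ≫ g.hom⟩

/-- 2-cells of `W.Sub`. -/
@[ext]
structure Hom₂ {a b : W.Sub} (f g : a ⟶ b) where
  hom : f.hom ⟶ g.hom
  mem : W.mem hom

instance (a b : W.Sub) : Category (a ⟶ b) where
  Hom f g := W.Hom₂ f g
  id f := ⟨𝟙 f.hom, W.id_mem _⟩
  comp α β := ⟨α.hom ≫ β.hom, W.comp_mem _ _ α.mem β.mem⟩
  id_comp _ := Hom₂.ext (Category.id_comp _)
  comp_id _ := Hom₂.ext (Category.comp_id _)
  assoc _ _ _ := Hom₂.ext (Category.assoc _ _ _)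

@[ext]
theorem hom_ext {a b : W.Sub} {f g : a ⟶ b} (h : f.hom = g.hom) : f = g := Hom₁.ext h

@[ext]
theorem hom₂_ext {a b : W.Sub} {f g : a ⟶ b} {α β : f ⟶ g}
    (h : Hom₂.hom α = Hom₂.hom β) : α = β := Hom₂.ext h

@[simp]
theorem id_hom (a : W.Sub) : (𝟙 a : a ⟶ a).hom = 𝟙 a.obj := rfl

@[simp]
theorem comp_hom {a b c : W.Sub} (f : a ⟶ b) (g : b ⟶ c) : (f ≫ g).hom = f.hom ≫ g.hom := rfl

@[simp]
theorem id_hom₂ {a b : W.Sub} (f : a ⟶ b) : Hom₂.hom (𝟙 f) = 𝟙 f.hom := rfl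

@[simp]
theorem comp_hom₂ {a b : W.Sub} {f g h : a ⟶ b} (α : f ⟶ g) (β : g ⟶ h) :
    Hom₂.hom (α ≫ β) = Hom₂.hom α ≫ Hom₂.hom β := rfl

theorem eqToHom_hom₂ {a b : W.Sub} {f g : a ⟶ b} (h : f = g) :
    Hom₂.hom (eqToHom h) = eqToHom (congrArg Hom₁.hom h) := by
  subst h; rfl

attribute [local simp] Strict.leftUnitor_eqToIso Strict.rightUnitor_eqToIso
  Strict.associator_eqToIso eqToHom_hom₂

instance : Bicategory W.Sub where
  whiskerLeft f _ _ α := Hom₂.mk (f.hom ◁ Hom₂.hom α) (W.whiskerLeft_mem _ _ (Hom₂.mem α))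
  whiskerRight α h := Hom₂.mk (Hom₂.hom α ▷ h.hom) (W.whiskerRight_mem _ _ (Hom₂.mem α))
  associator f g h := eqToIso (hom_ext W (Strict.assoc f.hom g.hom h.hom))
  leftUnitor f := eqToIso (hom_ext W (Strict.id_comp f.hom))
  rightUnitor f := eqToIso (hom_ext W (Strict.comp_id f.hom))
  whiskerLeft_id _ _ := by ext; simp
  whiskerLeft_comp _ _ _ _ _ _ := by ext; simp
  id_whiskerLeft _ := by ext; simp
  comp_whiskerLeft _ _ _ _ _ := by ext; simp
  id_whiskerRight _ _ := by ext; simp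
  comp_whiskerRight _ _ _ := by ext; simp
  whiskerRight_id _ := by ext; simp
  whiskerRight_comp _ _ _ := by ext; simp
  whisker_assoc _ _ _ _ _ := by ext; simp
  whisker_exchange _ _ := by ext; simpa using whisker_exchange _ _
  pentagon _ _ _ _ := by ext; simp
  triangle _ _ := by ext; simp

@[simp]
theorem whiskerLeft_hom₂ {a b c : W.Sub} (f : a ⟶ b) {g h : b ⟶ c} (α : g ⟶ h) :
    Hom₂.hom (f ◁ α) = f.hom ◁ Hom₂.hom α := rfl

@[simp]
theorem whiskerRight_hom₂ {a b c : W.Sub} {f g : a ⟶ b} (α : f ⟶ g) (h : b ⟶ c) :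
    Hom₂.hom (α ▷ h) = Hom₂.hom α ▷ h.hom := rfl

instance : Bicategory.Strict W.Sub where
  id_comp f := hom_ext W (Strict.id_comp f.hom)
  comp_id f := hom_ext W (Strict.comp_id f.hom)
  assoc f g h := hom_ext W (Strict.assoc f.hom g.hom h.hom)
  leftUnitor_eqToIso _ := rfl
  rightUnitor_eqToIso _ := rfl
  associator_eqToIso _ _ _ := rfl

variable {W}
variable {B' : Type u₂} [Bicategory.{w₂, v₂} B'] [Bicategory.Strict B'] {W' : TwoCellClass B'}

/-- A 2-functor sending 2-cells of the class `W` to 2-cells of the class `W'` restricts to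
a 2-functor `W.Sub → W'.Sub`. -/
def restrict (F : StrictPseudofunctor B B')
    (hF : ∀ {a b : B} {f g : a ⟶ b} (α : f ⟶ g), W.mem α → W'.mem (F.map₂ α)) :
    StrictPseudofunctor W.Sub W'.Sub :=
  StrictPseudofunctor.mk''
    { obj := fun a => ⟨F.obj a.obj⟩
      map := fun f => ⟨F.map f.hom⟩
      map₂ := fun α => ⟨F.map₂ α.hom, hF _ α.mem⟩
      map₂_id := fun f => hom₂_ext W' (F.map₂_id f.hom)
      map₂_comp := fun α β => hom₂_ext W' (F.map₂_comp α.hom β.hom)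
      map_id := fun a => hom_ext W' (F.map_id a.obj)
      map_comp := fun f g => hom_ext W' (F.map_comp f.hom g.hom)
      map₂_whisker_left := fun f _ _ α => hom₂_ext W' (by
        have := F.map₂_whisker_left f.hom (Hom₂.hom α)
        rw [F.mapComp_eq_eqToIso, F.mapComp_eq_eqToIso] at this
        simp only [comp_hom₂, eqToHom_hom₂, whiskerLeft_hom₂]
        exact this)
      map₂_whisker_right := fun α h => hom₂_ext W' (by
        have := F.map₂_whisker_right (Hom₂.hom α) h.hom
        rw [F.mapComp_eq_eqToIso, F.mapComp_eq_eqToIso] at this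
        simp only [comp_hom₂, eqToHom_hom₂, whiskerRight_hom₂]
        exact this) }

end TwoCellClass


/-! ### From restriction categories to local categories -/

section

variable {X Y Z : Type u} [Category.{v} X] [RestrictionStructure X]
  [Category.{v} Y] [RestrictionStructure Y] [Category.{v} Z] [RestrictionStructure Z]

variable (X) in
/-- The objects `(A, a)` of the split completion of `X`: an object `A` with a restriction
idempotent `a` on `A`. We regard `TotSplit X` as the category of total morphisms of the split
completion. -/
@[ext]
structure TotSplit where
  obj : X
  idem : obj ⟶ obj
  res_idem : res idem = idem

/-- A morphism `(A, a) ⟶ (B, b)` of the split completion is a morphism `f : A ⟶ B` with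
`a ≫ f ≫ b = f`; it is total when `res f` is the identity of `(A, a)`, that is, `res f = a`.
Both conditions together amount to `res f = a` and `f ≫ b = f`. -/
@[ext]
structure TotSplit.Hom (A B : TotSplit X) where
  hom : A.obj ⟶ B.obj
  res_hom : res hom = A.idem
  comp_idem : hom ≫ B.idem = hom

theorem TotSplit.idem_idem (A : TotSplit X) : A.idem ≫ A.idem = A.idem := by
  have := RestrictionStructure.res_comp_self A.idem
  rwa [A.res_idem] at this

theorem TotSplit.Hom.idem_comp {A B : TotSplit X} (f : TotSplit.Hom A B) :
    A.idem ≫ f.hom = f.hom := by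
  rw [← f.res_hom, res_comp_self]

instance : Category (TotSplit X) where
  Hom A B := TotSplit.Hom A B
  id A := ⟨A.idem, A.res_idem, A.idem_idem⟩
  comp f g := ⟨f.hom ≫ g.hom, by rw [res_of_res_eq g.res_hom f.comp_idem, f.res_hom],
    by rw [Category.assoc, g.comp_idem]⟩
  id_comp f := TotSplit.Hom.ext f.idem_comp
  comp_id f := TotSplit.Hom.ext f.comp_idem
  assoc _ _ _ := TotSplit.Hom.ext (Category.assoc _ _ _)

theorem TotSplit.hom_ext {A B : TotSplit X} {f g : A ⟶ B}
    (h : TotSplit.Hom.hom f = TotSplit.Hom.hom g) : f = g := TotSplit.Hom.ext h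

theorem TotSplit.comp_hom {A B C : TotSplit X} (f : A ⟶ B) (g : B ⟶ C) :
    TotSplit.Hom.hom (f ≫ g) = TotSplit.Hom.hom f ≫ TotSplit.Hom.hom g := rfl

theorem TotSplit.id_hom (A : TotSplit X) : TotSplit.Hom.hom (𝟙 A) = A.idem := rfl

/-- The enlargement `(A, 𝟙 A)` of `(A, a)`. -/
abbrev TotSplit.enlarge (A : TotSplit X) : TotSplit X := ⟨A.obj, 𝟙 A.obj, res_id _⟩

/-- The maximal inclusion `a : (A, a) ⟶ (A, 𝟙 A)`. -/
def TotSplit.incl (A : TotSplit X) : A ⟶ A.enlarge :=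
  TotSplit.Hom.mk (B := A.enlarge) A.idem A.res_idem (Category.comp_id _)

instance (A : TotSplit X) : Mono A.incl where
  right_cancellation {B} f g h := by
    have h' : f.hom ≫ A.idem = g.hom ≫ A.idem := congrArg TotSplit.Hom.hom h
    rw [f.comp_idem, g.comp_idem] at h'
    exact TotSplit.hom_ext h'

/-- A criterion for pullbacks of maximal inclusions. -/
theorem TotSplit.isPullback {N A : TotSplit X} (f : N ⟶ A.enlarge) (P : TotSplit X)
    (p : P ⟶ A) (m : P ⟶ N) (i : N.obj ⟶ P.obj) (hi : res i = res (f.hom ≫ A.idem))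
    (him : i ≫ m.hom = res (f.hom ≫ A.idem)) (hmi : m.hom ≫ i = P.idem)
    (w : p.hom = m.hom ≫ f.hom) :
    IsPullback p m A.incl f := by
  have hw : p ≫ A.incl = m ≫ f := by
    apply TotSplit.hom_ext
    rw [TotSplit.comp_hom, TotSplit.comp_hom, ← w]
    exact p.comp_idem
  have key : ∀ {Q : TotSplit X} (g : Q ⟶ A) (h : Q ⟶ N), g ≫ A.incl = h ≫ f →
      h.hom ≫ res (f.hom ≫ A.idem) = h.hom := by
    intro Q g h e
    have e' : g.hom ≫ A.idem = h.hom ≫ f.hom := congrArg TotSplit.Hom.hom e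
    rw [comp_res, ← Category.assoc, ← e', g.comp_idem, g.comp_idem, g.res_hom, ← h.res_hom,
      res_comp_self]
  refine ⟨⟨hw⟩, ⟨Limits.PullbackCone.IsLimit.mk hw
    (fun s => TotSplit.Hom.mk (s.snd.hom ≫ i) ?_ ?_) ?_ ?_ ?_⟩⟩
  · rw [← res_comp_res, hi, key s.fst s.snd s.condition, s.snd.res_hom]
  · rw [Category.assoc, ← hmi, ← Category.assoc i, him, ← Category.assoc,
      key s.fst s.snd s.condition]
  · intro s
    apply TotSplit.hom_ext
    change (s.snd.hom ≫ i) ≫ p.hom = s.fst.hom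
    rw [w, Category.assoc, ← Category.assoc i, him, ← Category.assoc,
      key s.fst s.snd s.condition]
    have e' : s.fst.hom ≫ A.idem = s.snd.hom ≫ f.hom := congrArg TotSplit.Hom.hom s.condition
    rw [← e', s.fst.comp_idem]
  · intro s
    apply TotSplit.hom_ext
    change (s.snd.hom ≫ i) ≫ m.hom = s.snd.hom
    rw [Category.assoc, him, key s.fst s.snd s.condition]
  · intro s t _ h
    apply TotSplit.hom_ext
    change t.hom = s.snd.hom ≫ i
    have : t.hom ≫ m.hom = s.snd.hom := congrArg TotSplit.Hom.hom h
    rw [← this, Category.assoc, hmi, t.comp_idem]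

/-- The standard pullback of the maximal inclusion of `A` along `f`. -/
abbrev TotSplit.pull {N A : TotSplit X} (f : N ⟶ A.enlarge) : TotSplit X :=
  ⟨N.obj, res (f.hom ≫ A.idem), res_res _⟩

theorem TotSplit.pull_le {N A : TotSplit X} (f : N ⟶ A.enlarge) :
    res (f.hom ≫ A.idem) ≫ N.idem = res (f.hom ≫ A.idem) := by
  have h : N.idem ≫ f.hom ≫ A.idem = f.hom ≫ A.idem := by
    rw [← Category.assoc, f.idem_comp]
  rw [← N.res_idem, res_comm, res_res_comp, N.res_idem, h]

def TotSplit.pullSnd {N A : TotSplit X} (f : N ⟶ A.enlarge) : TotSplit.pull f ⟶ N :=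
  TotSplit.Hom.mk (A := TotSplit.pull f) (res (f.hom ≫ A.idem)) (res_res _) (TotSplit.pull_le f)

def TotSplit.pullFst {N A : TotSplit X} (f : N ⟶ A.enlarge) : TotSplit.pull f ⟶ A :=
  TotSplit.Hom.mk (A := TotSplit.pull f) (f.hom ≫ A.idem) rfl
    (by rw [Category.assoc, A.idem_idem])

theorem TotSplit.isPullback_pull {N A : TotSplit X} (f : N ⟶ A.enlarge) :
    IsPullback (TotSplit.pullFst f) (TotSplit.pullSnd f) A.incl f := by
  refine TotSplit.isPullback f _ _ _ (res (f.hom ≫ A.idem)) (res_res _) (Partiality.res_idem _)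
    (Partiality.res_idem _) ?_
  change f.hom ≫ A.idem = res (f.hom ≫ A.idem) ≫ f.hom
  rw [← comp_res, A.res_idem]

instance : LocalStructure (TotSplit X) where
  L A := A.enlarge
  η A := A.incl
  L_L _ := rfl
  η_L _ := rfl
  mono_η A := inferInstance
  exists_pullback {M N} f := ⟨TotSplit.pull f, TotSplit.pullFst f, TotSplit.pullSnd f, rfl,
    TotSplit.isPullback_pull f, by
      refine Eq.trans ?_ (Category.comp_id _).symm
      exact TotSplit.hom_ext (TotSplit.pull_le f)⟩

theorem TotSplit.eqToHom_hom {o : X} {a b : o ⟶ o} {ha : res a = a} {hb : res b = b}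
    (h : (⟨o, a, ha⟩ : TotSplit X) = ⟨o, b, hb⟩) : TotSplit.Hom.hom (eqToHom h) = a := by
  have h' : a = b := by injection h
  subst h'
  rfl

theorem TotSplit.isPullback' {N A P : TotSplit X} {e : A.obj ⟶ A.obj} {he : res e = e}
    (h1 : e = 𝟙 A.obj) (f : N ⟶ (⟨A.obj, e, he⟩ : TotSplit X))
    (u : A ⟶ (⟨A.obj, e, he⟩ : TotSplit X)) (hu : u.hom = A.idem)
    (p : P ⟶ A) (m : P ⟶ N) (i : N.obj ⟶ P.obj) (hi : res i = res (f.hom ≫ A.idem))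
    (him : i ≫ m.hom = res (f.hom ≫ A.idem)) (hmi : m.hom ≫ i = P.idem)
    (w : p.hom = m.hom ≫ f.hom) :
    IsPullback p m u f := by
  subst h1
  have : u = A.incl := TotSplit.hom_ext hu
  rw [this]
  exact TotSplit.isPullback f P p m i hi him hmi w

theorem TotSplit.exists_of_isPullback {N A P : TotSplit X} {f : N ⟶ A.enlarge}
    {p : P ⟶ A} {m : P ⟶ N} (sq : IsPullback p m A.incl f) :
    ∃ i : N.obj ⟶ P.obj, res i = res (f.hom ≫ A.idem) ∧ i ≫ m.hom = res (f.hom ≫ A.idem) ∧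
      m.hom ≫ i = P.idem ∧ p.hom = m.hom ≫ f.hom := by
  let φ := sq.isoIsPullback _ _ (TotSplit.isPullback_pull f)
  have h1 : φ.inv ≫ m = TotSplit.pullSnd f := sq.isoIsPullback_inv_snd _ _ _
  have h2 : φ.hom ≫ TotSplit.pullSnd f = m := sq.isoIsPullback_hom_snd _ _ _
  refine ⟨φ.inv.hom, φ.inv.res_hom, congrArg TotSplit.Hom.hom h1, ?_, ?_⟩
  · have h3 : m.hom = φ.hom.hom := by
      rw [← h2]
      exact φ.hom.comp_idem
    rw [h3]
    exact congrArg TotSplit.Hom.hom φ.hom_inv_id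
  · exact p.comp_idem.symm.trans (congrArg TotSplit.Hom.hom sq.w)

/-- The local functor induced by a restriction functor: `(A, a) ↦ (F A, F a)`, `f ↦ F f`. -/
def TotSplit.map (F : RestrictionFunctor X Y) : LocalFunctor (TotSplit X) (TotSplit Y) where
  obj A := ⟨F.obj A.obj, F.map A.idem, by rw [← F.map_res, A.res_idem]⟩
  map f := ⟨F.map f.hom, (F.map_res _).symm.trans (congrArg (fun t => F.map t) f.res_hom),
    (F.map_comp _ _).symm.trans (congrArg (fun t => F.map t) f.comp_idem)⟩
  map_id _ := rfl
  map_comp f g := TotSplit.hom_ext (F.map_comp f.hom g.hom)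
  obj_L A := TotSplit.ext rfl (heq_of_eq (F.map_id A.obj))
  map_η A := by
    apply TotSplit.hom_ext
    rw [TotSplit.comp_hom]
    refine Eq.trans ?_ (congrArg (fun t => F.map A.idem ≫ t) (TotSplit.eqToHom_hom _).symm)
    exact (Category.comp_id _).symm
  map_pullback {P M N p m f} sq := by
    obtain ⟨i, hi, him, hmi, w⟩ := TotSplit.exists_of_isPullback sq
    refine TotSplit.isPullback' (F.map_id M.obj) _ _ rfl _ _ (F.map i) ?_ ?_ ?_ ?_
    · change res (F.map i) = res (F.map f.hom ≫ F.map M.idem)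
      rw [← F.map_res, hi, F.map_res, F.map_comp]
    · change F.map i ≫ F.map m.hom = res (F.map f.hom ≫ F.map M.idem)
      rw [← F.map_comp, him, F.map_res, F.map_comp]
    · change F.map m.hom ≫ F.map i = F.map P.idem
      rw [← F.map_comp, hmi]
    · change F.map p.hom = F.map m.hom ≫ F.map f.hom
      rw [w, F.map_comp]

/-- The local natural transformation with components `F a ≫ φ A`. -/
def TotSplit.map₂ {F G : RestrictionFunctor X Y} (φ : RestrictionTrans F G) :
    LocalTrans (TotSplit.map F) (TotSplit.map G) where
  app A := TotSplit.Hom.mk (A := (TotSplit.map F).obj A) (B := (TotSplit.map G).obj A)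
    (F.map A.idem ≫ φ.app A.obj)
    ((res_comp_total _ _ (φ.total _)).trans
      ((F.map_res _).symm.trans (congrArg (fun t => F.map t) A.res_idem)))
    (by
      have := φ.lax_naturality A.idem
      rw [A.res_idem] at this
      exact (Category.assoc _ _ _).trans this.symm)
  naturality {A B} f := by
    apply TotSplit.hom_ext
    change F.map f.hom ≫ F.map B.idem ≫ φ.app B.obj =
      (F.map A.idem ≫ φ.app A.obj) ≫ G.map f.hom
    rw [← Category.assoc, ← F.map_comp, f.comp_idem, φ.lax_naturality, f.res_hom, Category.assoc]

theorem TotSplit.map₂_isTotal {F G : RestrictionFunctor X Y} (φ : RestrictionTrans F G)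
    (hφ : φ.IsNatural) : (TotSplit.map₂ φ).IsTotal := fun A => by
  have h : res ((F.map (𝟙 A.obj) ≫ φ.app A.obj) ≫ G.map A.idem) = F.map A.idem := by
    rw [F.map_id, Category.id_comp, ← hφ, res_comp_total _ _ (φ.total _), ← F.map_res, A.res_idem]
  refine TotSplit.isPullback' (G.map_id A.obj) _ _ rfl _ _ (F.map A.idem) ?_ ?_ ?_ ?_
  · refine Eq.trans ?_ h.symm
    exact (F.map_res _).symm.trans (congrArg (fun t => F.map t) A.res_idem)
  · refine Eq.trans ?_ h.symm
    exact (F.map_comp _ _).symm.trans (congrArg (fun t => F.map t) A.idem_idem)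
  · exact (F.map_comp _ _).symm.trans (congrArg (fun t => F.map t) A.idem_idem)
  · change F.map A.idem ≫ φ.app A.obj = F.map A.idem ≫ F.map (𝟙 A.obj) ≫ φ.app A.obj
    rw [F.map_id, Category.id_comp]

end

/-- The 2-functor sending a restriction category to the local category of total morphisms of its
split completion. -/
def Llax : StrictPseudofunctor RCatLax.{u} LCatLax.{u} :=
  StrictPseudofunctor.mk''
    { obj := fun X => ⟨TotSplit X.carrier⟩
      map := fun F => TotSplit.map F
      map₂ := fun φ => TotSplit.map₂ φ
      map₂_id := fun F => by
        apply LocalTrans.hom_ext; intro A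
        exact TotSplit.hom_ext (Category.comp_id _)
      map₂_comp := fun {X Y F G H} φ ψ => by
        apply LocalTrans.hom_ext; intro A
        apply TotSplit.hom_ext
        have := RestrictionTrans.lax_naturality φ A.idem
        rw [A.res_idem] at this
        change F.map A.idem ≫ φ.app A.obj ≫ ψ.app A.obj =
          (F.map A.idem ≫ φ.app A.obj) ≫ G.map A.idem ≫ ψ.app A.obj
        rw [← Category.assoc, this]
        simp only [Category.assoc]
        rw [← G.map_comp_assoc, A.idem_idem]
      map_id := fun X => rfl
      map_comp := fun F G => rfl
      map₂_whisker_left := fun F _ _ φ => by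
        apply LocalTrans.hom_ext; intro A
        exact ((Category.id_comp _).trans (Category.comp_id _)).symm
      map₂_whisker_right := fun φ H => by
        apply LocalTrans.hom_ext; intro A
        refine Eq.trans ?_ ((Category.id_comp _).trans (Category.comp_id _)).symm
        exact TotSplit.hom_ext (H.map_comp _ _).symm }

/-! ### From local categories to restriction categories -/

theorem isPullback_mono {C : Type u} [Category.{v} C] {P Q R : C} (f : P ⟶ Q) (g : Q ⟶ R) [Mono g] :
    IsPullback f (𝟙 P) g (f ≫ g) := by
  have h1 : IsPullback f (𝟙 P) (𝟙 Q) f := IsPullback.of_vert_isIso ⟨by simp⟩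
  have h2 := h1.paste_horiz (IsKernelPair.id_of_mono g)
  rwa [Category.comp_id] at h2

section

variable {C D E : Type u} [Category.{v} C] [LocalStructure C]
  [Category.{v} D] [LocalStructure D] [Category.{v} E] [LocalStructure E]

/-- A partial morphism `(U, f)` from `M` to `N`: an object `U` with `L U = M` and a morphism
`f : U ⟶ N`. -/
structure PSpan (M N : C) where
  dom : C
  L_dom : L dom = M
  map : dom ⟶ N

namespace PSpan

/-- The left leg `η U : U ⟶ L U = M` of the span `(U, f)`. -/
def leg {M N : C} (s : PSpan M N) : s.dom ⟶ M := η s.dom ≫ eqToHom s.L_dom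

instance {M N : C} (s : PSpan M N) : Mono s.leg := by
  unfold leg
  infer_instance

/-- Two spans `(U, f)` and `(V, g)` are isomorphic when there is an isomorphism `U ≅ V`
compatible with the maximal inclusions and with `f` and `g`. -/
def Rel {M N : C} (s t : PSpan M N) : Prop :=
  ∃ φ : s.dom ≅ t.dom, φ.hom ≫ t.leg = s.leg ∧ φ.hom ≫ t.map = s.map

instance setoid (M N : C) : Setoid (PSpan M N) where
  r := Rel
  iseqv :=
    { refl := fun s => ⟨Iso.refl _, Category.id_comp _, Category.id_comp _⟩
      symm := fun ⟨φ, h, h'⟩ => ⟨φ.symm, by simp [← h], by simp [← h']⟩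
      trans := fun ⟨φ, h, h'⟩ ⟨ψ, k, k'⟩ => ⟨φ ≪≫ ψ, by simp [← h, ← k], by simp [← h', ← k']⟩ }

/-- `w` is a composite of the spans `s` and `t`, formed by means of a pullback. -/
def IsComp {M N P : C} (s : PSpan M N) (t : PSpan N P) (w : PSpan M P) : Prop :=
  ∃ (p : w.dom ⟶ t.dom) (m : w.dom ⟶ s.dom), IsPullback p m t.leg s.map ∧
    m ≫ s.leg = w.leg ∧ p ≫ t.map = w.map

theorem exists_pullback' {V U N : C} (h : L V = N) (f : U ⟶ N) :
    ∃ (P : C) (p : P ⟶ V) (m : P ⟶ U) (h' : L P = L U),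
      IsPullback p m (η V ≫ eqToHom h) f ∧ m ≫ η U = η P ≫ eqToHom h' := by
  subst h
  simpa using exists_pullback f

theorem exists_isComp {M N P : C} (s : PSpan M N) (t : PSpan N P) :
    ∃ w : PSpan M P, IsComp s t w := by
  obtain ⟨W, p, m, h, sq, e⟩ := exists_pullback' t.L_dom s.map
  refine ⟨⟨W, h.trans s.L_dom, p ≫ t.map⟩, p, m, sq, ?_, rfl⟩
  unfold leg
  rw [← Category.assoc, e, Category.assoc, eqToHom_trans]

theorem IsComp.unique {M N P : C} {s : PSpan M N} {t : PSpan N P} {w w' : PSpan M P}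
    (h : IsComp s t w) (h' : IsComp s t w') : w ≈ w' := by
  obtain ⟨p, m, sq, hm, hp⟩ := h
  obtain ⟨p', m', sq', hm', hp'⟩ := h'
  refine ⟨sq.isoIsPullback _ _ sq', ?_, ?_⟩
  · rw [← hm', ← hm, ← Category.assoc, sq.isoIsPullback_hom_snd]
  · rw [← hp', ← hp, ← Category.assoc, sq.isoIsPullback_hom_fst]

theorem IsComp.congr {M N P : C} {s s' : PSpan M N} {t t' : PSpan N P} {w : PSpan M P}
    (hs : s ≈ s') (ht : t ≈ t') (h : IsComp s t w) : IsComp s' t' w := by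
  obtain ⟨p, m, sq, hm, hp⟩ := h
  obtain ⟨φ, h1, h2⟩ := hs
  obtain ⟨ψ, k1, k2⟩ := ht
  refine ⟨p ≫ ψ.hom, m ≫ φ.hom, ?_, ?_, ?_⟩
  · exact sq.of_iso (Iso.refl _) ψ φ (Iso.refl _) (by simp) (by simp) (by simp [k1]) (by simp [h2])
  · rw [Category.assoc, h1, hm]
  · rw [Category.assoc, k2, hp]

/-- The chosen composite of two spans. -/
def comp {M N P : C} (s : PSpan M N) (t : PSpan N P) : PSpan M P := (exists_isComp s t).choose

theorem isComp_comp {M N P : C} (s : PSpan M N) (t : PSpan N P) : IsComp s t (s.comp t) :=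
  (exists_isComp s t).choose_spec

theorem IsComp.assoc {M N P Q : C} {s : PSpan M N} {t : PSpan N P} {r : PSpan P Q}
    {w₁ : PSpan M P} {w₂ : PSpan N Q} {w : PSpan M Q} (h₁ : IsComp s t w₁) (h₂ : IsComp t r w₂)
    (h : IsComp w₁ r w) : IsComp s w₂ w := by
  obtain ⟨p₁, m₁, sq₁, hm₁, hp₁⟩ := h₁
  obtain ⟨p₂, m₂, sq₂, hm₂, hp₂⟩ := h₂
  obtain ⟨p, m, sq, hm, hp⟩ := h
  have hw : p ≫ r.leg = (m ≫ p₁) ≫ t.map := by rw [sq.w, ← hp₁, Category.assoc]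
  have e1 : sq₂.lift p (m ≫ p₁) hw ≫ p₂ = p := sq₂.lift_fst _ _ _
  have e2 : sq₂.lift p (m ≫ p₁) hw ≫ m₂ = m ≫ p₁ := sq₂.lift_snd _ _ _
  have sq' : IsPullback (sq₂.lift p (m ≫ p₁) hw) m m₂ p₁ := by
    refine IsPullback.of_right ?_ e2 sq₂
    rw [e1, hp₁]
    exact sq
  have sq'' := sq'.paste_vert sq₁
  rw [hm₂] at sq''
  exact ⟨_, _, sq'', by rw [Category.assoc, hm₁, hm], by rw [← hp₂, ← Category.assoc, e1, hp]⟩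

/-- The restriction `(U, η U)` of the span `(U, f)`. -/
def restr {M N : C} (s : PSpan M N) : PSpan M M := ⟨s.dom, s.L_dom, s.leg⟩

@[simp]
theorem restr_leg {M N : C} (s : PSpan M N) : s.restr.leg = s.leg := rfl

@[simp]
theorem restr_map {M N : C} (s : PSpan M N) : s.restr.map = s.leg := rfl

/-- The span `(M, f)` of a morphism `f : M ⟶ N` whose domain is a total object. -/
def graph {M N : C} (hM : IsTotalObj M) (f : M ⟶ N) : PSpan M N := ⟨M, hM.choose, f⟩

@[simp]
theorem graph_leg {M N : C} (hM : IsTotalObj M) (f : M ⟶ N) : (graph hM f).leg = 𝟙 M := by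
  obtain ⟨h, e⟩ := hM
  change η M ≫ eqToHom h = 𝟙 M
  rw [e, eqToHom_trans, eqToHom_refl]

theorem isComp_graph_left {M N P : C} (hM : IsTotalObj M) (f : M ⟶ N) (t : PSpan N P)
    (w : PSpan M P) (p : w.dom ⟶ t.dom) (sq : IsPullback p w.leg t.leg f)
    (hp : p ≫ t.map = w.map) : IsComp (graph hM f) t w :=
  ⟨p, w.leg, sq, by rw [graph_leg]; exact Category.comp_id _, hp⟩

theorem isComp_graph_right {M N P : C} (s : PSpan M N) (hN : IsTotalObj N) (g : N ⟶ P) :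
    IsComp s (graph hN g) ⟨s.dom, s.L_dom, s.map ≫ g⟩ := by
  refine ⟨s.map, 𝟙 _, ?_, Category.id_comp _, rfl⟩
  have : IsIso (graph hN g).leg := by rw [graph_leg]; exact IsIso.id _
  refine IsPullback.of_vert_isIso ⟨?_⟩
  rw [graph_leg, Category.id_comp]
  exact Category.comp_id _

end PSpan

variable (C) in
/-- The objects of the restriction category associated with `C`: the total objects of `C`. -/
structure ParObj where
  obj : C
  total : IsTotalObj obj

/-- Morphisms are isomorphism classes of spans; composition is composition of spans. -/
instance : Category (ParObj C) where
  Hom M N := Quotient (PSpan.setoid M.obj N.obj)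
  id M := ⟦PSpan.graph M.total (𝟙 M.obj)⟧
  comp := Quotient.map₂ PSpan.comp (fun _ _ hs _ _ ht =>
    ((PSpan.isComp_comp _ _).congr hs ht).unique (PSpan.isComp_comp _ _))
  id_comp {M N} f := by
    induction f using Quotient.ind with | _ s
    refine Quotient.sound ((PSpan.isComp_comp _ _).unique ?_)
    exact PSpan.isComp_graph_left _ _ _ _ (𝟙 _) (IsPullback.of_horiz_isIso ⟨by simp⟩)
      (Category.id_comp _)
  comp_id {M N} f := by
    induction f using Quotient.ind with | _ s
    refine Quotient.sound ((PSpan.isComp_comp _ _).unique ?_)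
    have := PSpan.isComp_graph_right s N.total (𝟙 N.obj)
    rwa [Category.comp_id] at this
  assoc {M N P Q} f g h := by
    induction f using Quotient.ind with | _ s
    induction g using Quotient.ind with | _ t
    induction h using Quotient.ind with | _ r
    refine Quotient.sound (PSpan.IsComp.unique ?_ (PSpan.isComp_comp s (t.comp r)))
    exact PSpan.IsComp.assoc (PSpan.isComp_comp s t) (PSpan.isComp_comp t r)
      (PSpan.isComp_comp (s.comp t) r)

namespace ParObj

/-- The morphism represented by a span. -/
def cls {M N : ParObj C} (s : PSpan M.obj N.obj) : M ⟶ N := Quotient.mk (PSpan.setoid _ _) s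

theorem ind {M N : ParObj C} {motive : (M ⟶ N) → Prop} (h : ∀ s, motive (cls s)) (f : M ⟶ N) :
    motive f := Quotient.ind h f

theorem cls_comp {M N P : ParObj C} {s : PSpan M.obj N.obj} {t : PSpan N.obj P.obj}
    {w : PSpan M.obj P.obj} (h : PSpan.IsComp s t w) :
    (cls s : M ⟶ N) ≫ (cls t : N ⟶ P) = cls w :=
  Quotient.sound ((PSpan.isComp_comp s t).unique h)

theorem cls_graph_id (M : ParObj C) : (cls (PSpan.graph M.total (𝟙 M.obj)) : M ⟶ M) = 𝟙 M := rfl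

def restr {M N : ParObj C} : (M ⟶ N) → (M ⟶ M) :=
  Quotient.map PSpan.restr (fun _ _ ⟨φ, h, _⟩ => ⟨φ, h, h⟩)

theorem restr_cls {M N : ParObj C} (s : PSpan M.obj N.obj) :
    restr (cls s : M ⟶ N) = cls s.restr := rfl

instance : RestrictionStructure (ParObj C) where
  res f := restr f
  res_comp_self {M N} f := by
    induction f using ParObj.ind with | _ s
    exact cls_comp ⟨𝟙 _, 𝟙 _, IsKernelPair.id_of_mono s.leg, Category.id_comp _, Category.id_comp _⟩
  res_comm {M N P} f g := by
    induction f using ParObj.ind with | _ s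
    induction g using ParObj.ind with | _ t
    obtain ⟨w, h⟩ := PSpan.exists_isComp s.restr t.restr
    refine (cls_comp h).trans (Eq.symm ?_)
    obtain ⟨p, m, sq, hm, hp⟩ := h
    exact cls_comp ⟨m, p, sq.flip, by rw [← hm]; exact sq.w, by rw [← hp]; exact sq.w.symm⟩
  res_res_comp {M N P} f g := by
    induction f using ParObj.ind with | _ s
    induction g using ParObj.ind with | _ t
    obtain ⟨w, h⟩ := PSpan.exists_isComp t.restr s
    rw [restr_cls, restr_cls, cls_comp h, restr_cls]
    obtain ⟨p, m, sq, hm, hp⟩ := h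
    exact cls_comp ⟨p, m, sq, hm, sq.w.trans hm⟩
  comp_res {M N P} f g := by
    induction f using ParObj.ind with | _ s
    induction g using ParObj.ind with | _ t
    obtain ⟨w, h⟩ := PSpan.exists_isComp s t
    rw [cls_comp h, restr_cls, restr_cls]
    obtain ⟨p, m, sq, hm, hp⟩ := h
    refine (cls_comp (w := ⟨w.dom, w.L_dom, p ≫ t.leg⟩) ⟨p, m, sq, hm, rfl⟩).trans (Eq.symm ?_)
    refine cls_comp ⟨m, 𝟙 _, ?_, Category.id_comp _, sq.w.symm⟩
    rw [PSpan.restr_map, ← hm]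
    exact isPullback_mono m s.leg

theorem res_cls {M N : ParObj C} (s : PSpan M.obj N.obj) :
    res (cls s : M ⟶ N) = cls s.restr := rfl

end ParObj

theorem LocalFunctor.isTotalObj (F : LocalFunctor C D) {M : C} (hM : IsTotalObj M) :
    IsTotalObj (F.obj M) := by
  obtain ⟨h, e⟩ := hM
  refine ⟨(F.obj_L M).symm.trans (congrArg (fun t => F.obj t) h), ?_⟩
  have h1 := F.map_η M
  rw [e, eqToHom_map] at h1
  have h2 := congrArg (fun t => t ≫ eqToHom (F.obj_L M)) h1
  simpa using h2.symm

/-- The image `(F U, F f)` of a span `(U, f)` under a local functor. -/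
def PSpan.image (F : LocalFunctor C D) {M N : C} (s : PSpan M N) :
    PSpan (F.obj M) (F.obj N) :=
  ⟨F.obj s.dom, (F.obj_L _).symm.trans (congrArg (fun t => F.obj t) s.L_dom), F.map s.map⟩

theorem PSpan.image_leg (F : LocalFunctor C D) {M N : C} (s : PSpan M N) :
    (s.image F).leg = F.map s.leg := by
  unfold PSpan.leg
  rw [F.map_comp, F.map_η, eqToHom_map, Category.assoc, eqToHom_trans]
  rfl

theorem PSpan.image_isComp (F : LocalFunctor C D) {M N P : C} {s : PSpan M N} {t : PSpan N P}
    {w : PSpan M P} (h : IsComp s t w) : IsComp (s.image F) (t.image F) (w.image F) := by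
  obtain ⟨p, m, sq, hm, hp⟩ := h
  refine ⟨F.map p, F.map m, ?_, ?_, ?_⟩
  · rw [PSpan.image_leg]
    exact F.map_pullback_eqToHom _ sq
  · rw [PSpan.image_leg, PSpan.image_leg, ← hm, F.map_comp]
    rfl
  · exact (F.map_comp _ _).symm.trans (congrArg (fun t => F.map t) hp)

theorem PSpan.image_rel (F : LocalFunctor C D) {M N : C} {s t : PSpan M N} (h : s ≈ t) :
    s.image F ≈ t.image F := by
  obtain ⟨φ, h1, h2⟩ := h
  refine ⟨F.toFunctor.mapIso φ, ?_, ?_⟩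
  · rw [PSpan.image_leg, PSpan.image_leg, ← h1, F.map_comp]
    rfl
  · exact (F.map_comp _ _).symm.trans (congrArg (fun t => F.map t) h2)

/-- The restriction functor induced by a local functor: `M ↦ F M`, `(U, f) ↦ (F U, F f)`. -/
def ParObj.map (F : LocalFunctor C D) : RestrictionFunctor (ParObj C) (ParObj D) where
  obj M := ⟨F.obj M.obj, F.isTotalObj M.total⟩
  map f := Quotient.map (PSpan.image F) (fun _ _ h => PSpan.image_rel F h) f
  map_id M := congrArg (fun t => ParObj.cls (PSpan.graph (F.isTotalObj M.total) t)) (F.map_id _)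
  map_comp {M N P} f g := by
    induction f using ParObj.ind with | _ s
    induction g using ParObj.ind with | _ t
    obtain ⟨w, h⟩ := PSpan.exists_isComp s t
    rw [ParObj.cls_comp h]
    exact (ParObj.cls_comp (PSpan.image_isComp F h)).symm
  map_res {M N} f := by
    induction f using ParObj.ind with | _ s
    refine congrArg ParObj.cls ?_
    change PSpan.mk _ _ _ = PSpan.mk _ _ _
    congr 1
    exact (PSpan.image_leg F s).symm

theorem ParObj.map_cls (F : LocalFunctor C D) {M N : ParObj C} (s : PSpan M.obj N.obj) :
    (ParObj.map F).map (ParObj.cls s : M ⟶ N) = ParObj.cls (s.image F) := rfl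

theorem LocalTrans.naturality_leg {F G : LocalFunctor C D} (φ : LocalTrans F G) {M N : C}
    (s : PSpan M N) : (s.image F).leg ≫ φ.app M = φ.app s.dom ≫ (s.image G).leg := by
  rw [PSpan.image_leg, PSpan.image_leg]
  exact φ.naturality s.leg

theorem LocalTrans.IsTotal.isPullback {F G : LocalFunctor C D} {φ : LocalTrans F G}
    (hφ : φ.IsTotal) {U M : C} (h : L U = M) :
    IsPullback (φ.app U) (F.map (η U ≫ eqToHom h)) (G.map (η U ≫ eqToHom h)) (φ.app M) := by
  subst h
  simpa using hφ U

theorem ParObj.res_graph {M N : ParObj C} (f : M.obj ⟶ N.obj) :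
    res (ParObj.cls (PSpan.graph M.total f) : M ⟶ N) = 𝟙 M := by
  rw [ParObj.res_cls, ← ParObj.cls_graph_id]
  exact congrArg (fun t => ParObj.cls (M := M) (N := M) (PSpan.mk M.obj M.total.choose t))
    (PSpan.graph_leg M.total f)

theorem ParObj.graph_comp {M N P : ParObj C} (f : M.obj ⟶ N.obj) (g : N.obj ⟶ P.obj) :
    (ParObj.cls (PSpan.graph M.total f) : M ⟶ N) ≫ (ParObj.cls (PSpan.graph N.total g) : N ⟶ P) =
      ParObj.cls (PSpan.graph M.total (f ≫ g)) :=
  ParObj.cls_comp (PSpan.isComp_graph_right _ _ _)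

/-- The restriction natural transformation with components `(F M, φ M)`. -/
def ParObj.map₂ {F G : LocalFunctor C D} (φ : LocalTrans F G) :
    RestrictionTrans (ParObj.map F) (ParObj.map G) where
  app M := ParObj.cls (M := (ParObj.map F).obj M) (N := (ParObj.map G).obj M)
    (PSpan.graph (F.isTotalObj M.total) (φ.app M.obj))
  total M := ParObj.res_graph (M := (ParObj.map F).obj M) (N := (ParObj.map G).obj M) _
  lax_naturality {M N} f := by
    induction f using ParObj.ind with | _ s
    rw [ParObj.res_cls, ← Category.assoc, ParObj.map_cls, ParObj.map_cls, ParObj.map_cls]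
    refine (ParObj.cls_comp (PSpan.isComp_graph_right _ _ _)).trans (Eq.symm ?_)
    refine (congrArg (fun t => t ≫ _) (ParObj.cls_comp (PSpan.isComp_graph_right _ _ _))).trans ?_
    refine ParObj.cls_comp ⟨φ.app s.dom, 𝟙 _, ?_, Category.id_comp _, (φ.naturality s.map).symm⟩
    have h : F.map s.leg ≫ φ.app M.obj = φ.app s.dom ≫ (s.image G).leg := by
      rw [PSpan.image_leg]
      exact φ.naturality s.leg
    change IsPullback _ _ _ (F.map s.leg ≫ φ.app M.obj)
    rw [h]
    exact isPullback_mono (Q := (s.image G).dom) (φ.app s.dom) (s.image G).leg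

theorem ParObj.map₂_isNatural {F G : LocalFunctor C D} (φ : LocalTrans F G) (hφ : φ.IsTotal) :
    (ParObj.map₂ φ).IsNatural := by
  intro M N f
  induction f using ParObj.ind with | _ s
  rw [ParObj.map_cls, ParObj.map_cls]
  refine (ParObj.cls_comp (PSpan.isComp_graph_right _ _ _)).trans (Eq.symm ?_)
  refine ParObj.cls_comp (PSpan.isComp_graph_left _ _ _ _ (φ.app s.dom) ?_
    (φ.naturality s.map).symm)
  have h := hφ.isPullback s.L_dom
  have h1 := PSpan.image_leg F s
  have h2 := PSpan.image_leg G s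
  unfold PSpan.leg at h1 h2
  rw [← h1, ← h2] at h
  exact h

end

/-- The 2-functor sending a local category to the restriction category of its total objects and
isomorphism classes of spans. -/
def Rlax : StrictPseudofunctor LCatLax.{u} RCatLax.{u} :=
  StrictPseudofunctor.mk''
    { obj := fun C => ⟨ParObj C.carrier⟩
      map := fun F => ParObj.map F
      map₂ := fun φ => ParObj.map₂ φ
      map₂_id := fun F => by
        apply RestrictionTrans.hom_ext; intro A
        rfl
      map₂_comp := fun {X Y F G H} φ ψ => by
        apply RestrictionTrans.hom_ext; intro M
        exact (ParObj.graph_comp (M := (ParObj.map F).obj M) (N := (ParObj.map G).obj M)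
          (P := (ParObj.map H).obj M) _ _).symm
      map_id := fun X => RestrictionFunctor.ext_functor
        (CategoryTheory.Functor.ext (fun _ => rfl) (fun M N f => by
          induction f using ParObj.ind with | _ s
          refine Eq.trans ?_ ((Category.id_comp _).trans (Category.comp_id _)).symm
          rfl))
      map_comp := fun F G => RestrictionFunctor.ext_functor
        (CategoryTheory.Functor.ext (fun _ => rfl) (fun M N f => by
          induction f using ParObj.ind with | _ s
          refine Eq.trans ?_ ((Category.id_comp _).trans (Category.comp_id _)).symm
          rfl))
      map₂_whisker_left := fun F _ _ φ => by
        apply RestrictionTrans.hom_ext; intro A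
        rw [RestrictionTrans.comp_app, RestrictionTrans.comp_app, RestrictionTrans.eqToHom_app,
          RestrictionTrans.eqToHom_app]
        refine Eq.trans ?_ ((Category.id_comp _).trans (Category.comp_id _)).symm
        rfl
      map₂_whisker_right := fun φ H => by
        apply RestrictionTrans.hom_ext; intro A
        rw [RestrictionTrans.comp_app, RestrictionTrans.comp_app, RestrictionTrans.eqToHom_app,
          RestrictionTrans.eqToHom_app]
        refine Eq.trans ?_ ((Category.id_comp _).trans (Category.comp_id _)).symm
        rfl }

/-! ### The 2-categories with total 2-cells -/

/-- The class of total natural transformations between restriction functors. -/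
def totalRTrans : TwoCellClass RCatLax.{u} where
  mem α := RestrictionTrans.IsNatural α
  id_mem _ _ _ f := (Category.comp_id _).trans (Category.id_comp _).symm
  comp_mem α β hα hβ _ _ f := by
    rw [RestrictionTrans.comp_app, RestrictionTrans.comp_app, ← Category.assoc, hα f,
      Category.assoc, hβ f, Category.assoc]
  whiskerLeft_mem F _ _ α hα _ _ f := hα (F.map f)
  whiskerRight_mem α H hα _ _ f :=
    (H.map_comp _ _).symm.trans ((congrArg (fun t => H.map t) (hα f)).trans (H.map_comp _ _))

/-- The class of total natural transformations between local functors. -/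
def totalLTrans : TwoCellClass LCatLax.{u} where
  mem α := LocalTrans.IsTotal α
  id_mem _ := LocalTrans.isTotal_of_isIso _ (fun _ => IsIso.id _)
  comp_mem α β hα hβ := LocalTrans.isTotal_comp α β hα hβ
  whiskerLeft_mem F _ _ α hα := LocalTrans.isTotal_whiskerLeft F α hα
  whiskerRight_mem α H hα := LocalTrans.isTotal_whiskerRight α H hα

/-- The 2-category of restriction categories, restriction functors and total natural
transformations. -/
abbrev RCat := (totalRTrans.{u}).Sub

/-- The 2-category of local categories, local functors and total natural transformations. -/
abbrev LCat := (totalLTrans.{u}).Sub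

/-- The restriction of `Llax` to total natural transformations. -/
def Ltot : StrictPseudofunctor RCat.{u} LCat.{u} :=
  TwoCellClass.restrict Llax (fun α hα => TotSplit.map₂_isTotal α hα)

/-- The restriction of `Rlax` to total natural transformations. -/
def Rtot : StrictPseudofunctor LCat.{u} RCat.{u} :=
  TwoCellClass.restrict Rlax (fun α hα => ParObj.map₂_isNatural α hα)

/-! ### 2-equivalences -/

section

variable {B : Type u₁} [Bicategory.{w₁, v₁} B] [Bicategory.Strict B]
  {B' : Type u₂} [Bicategory.{w₂, v₂} B'] [Bicategory.Strict B']

/-- A (strict) 2-natural transformation between 2-functors: a family of 1-cells, strictly natural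
with respect to 1-cells and with respect to 2-cells. -/
structure TwoNatTrans (F G : StrictPseudofunctor B B') where
  app : ∀ a : B, F.obj a ⟶ G.obj a
  naturality : ∀ {a b : B} (f : a ⟶ b), F.map f ≫ app b = app a ≫ G.map f
  naturality₂ : ∀ {a b : B} {f g : a ⟶ b} (α : f ⟶ g),
    F.map₂ α ▷ app b ≫ eqToHom (naturality g) = eqToHom (naturality f) ≫ app a ◁ G.map₂ α

/-- A 1-cell of a 2-category is an internal equivalence when it has an inverse up to invertible
2-cells. -/
def IsEquivalence₁ {a b : B} (f : a ⟶ b) : Prop :=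
  ∃ g : b ⟶ a, Nonempty (f ≫ g ≅ 𝟙 a) ∧ Nonempty (g ≫ f ≅ 𝟙 b)

/-- A 1-cell of a 2-category is an isomorphism when it has a strict inverse. -/
def IsIso₁ {a b : B} (f : a ⟶ b) : Prop :=
  ∃ g : b ⟶ a, f ≫ g = 𝟙 a ∧ g ≫ f = 𝟙 b

/-- A 2-equivalence formed by two 2-functors from `B` to `B'` and back: a strict 2-adjunction
`F ⊣ G`, given by 2-natural transformations `unit : 1 ⟶ F ⋙ G` and `counit : G ⋙ F ⟶ 1` that
satisfy the triangle identities, such that all components of the unit and of the counit are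
internal equivalences. -/
structure TwoEquivalence (F : StrictPseudofunctor B B') (G : StrictPseudofunctor B' B) where
  unit : TwoNatTrans (StrictPseudofunctor.id B) (F.comp G)
  counit : TwoNatTrans (G.comp F) (StrictPseudofunctor.id B')
  left_triangle : ∀ a : B, F.map (unit.app a) ≫ counit.app (F.obj a) = 𝟙 (F.obj a)
  right_triangle : ∀ b : B', unit.app (G.obj b) ≫ G.map (counit.app b) = 𝟙 (G.obj b)
  unit_equivalence : ∀ a : B, IsEquivalence₁ (unit.app a)
  counit_equivalence : ∀ b : B', IsEquivalence₁ (counit.app b)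

end

end Partiality

end

/-!
A partial morphism amounts to its domain of definition together with a total morphism out of it, and
both 2-functors only repackage this fact.

For a local category `C`, the unit sends `U` to the restriction idempotent `(U, η U)` on `L U` and
`f : U ⟶ V` to the class of the span `(U, f ≫ η V)`. Since `η U` is mono, an automorphism
of `U` over `L U` is the identity; from this, the functor is faithful (`ParObj.ofHom_injective`), full
(`ParObj.ofHom_surjective`), and surjective on objects (`ParObj.exists_domain_eq`). Being an
equivalence of categories it preserves all pullbacks, so that it is a local functor
(`ParObj.unit`). Any section on objects extends to a pseudo-inverse; to be a local functor the section
has to commute strictly with enlargements, which is arranged by sending the total object `(M, 𝟙 M)`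
to `M` itself (`ParObj.domainSection`). The unit is an isomorphism exactly when it is injective on
objects, and it identifies `U` with `V` exactly when `L U = L V` and there is an isomorphism `U ≅ V`
over this object (`ParObj.domain_eq_iff`).

For a restriction category `X`, the total objects of the split completion are the pairs `(A, 𝟙 A)`,
and a partial morphism from `(A, 𝟙 A)` to `(B, 𝟙 B)` is a span with domain `(A, res f)` for a
unique `f : A ⟶ B` (`TotSplit.exists_spanOf_eq`, `TotSplit.spanOf_rel`). So `f ↦ (res f, f)` is an
isomorphism of restriction categories, whose inverse is the counit (`TotSplit.counit`).

Strict naturality and the triangle identities are computations with representing spans. Equalities of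
objects are handled by `ParObj.domain U N h`, which carries the equality `h : L U = N` explicitly.
Finally, isomorphisms of local functors have total components and the counit is strictly invertible,
so the whole 2-equivalence restricts to total 2-cells (`TwoEquivalence.restrict`).
-/

noncomputable section

namespace Partiality

open RestrictionStructure LocalStructure Bicategory

/-! ### The unit -/

section

variable {C D : Type u} [Category.{u} C] [LocalStructure C] [Category.{u} D] [LocalStructure D]

theorem eqToHom_comp_comp_eqToHom_comp_eqToHom {X : Type*} [Category X] {A A' B B' : X}
    (h : A' = A) (f : A ⟶ B) (k : B = B') (l : B' = B) :
    (eqToHom h ≫ f ≫ eqToHom k) ≫ eqToHom l = eqToHom h ≫ f := by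
  simp

theorem TotSplit.eqToHom_comp_comp_eqToHom_hom {X : Type*} [Category X] [RestrictionStructure X]
    {A A' B B' : TotSplit X} (h : A' = A) (k : B = B') (f : A ⟶ B) :
    TotSplit.Hom.hom (eqToHom h ≫ f ≫ eqToHom k) =
      eqToHom (congrArg TotSplit.obj h) ≫ TotSplit.Hom.hom f ≫
        eqToHom (congrArg TotSplit.obj k) := by
  subst h k
  simp

namespace ParObj

theorem eqToHom_comp_cls_comp_eqToHom {M M' N N' : ParObj C} (hM : M' = M) (hN : N = N')
    (s : PSpan M.obj N.obj) :
    eqToHom hM ≫ (cls s : M ⟶ N) ≫ eqToHom hN =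
      cls ⟨s.dom, s.L_dom.trans (congrArg ParObj.obj hM.symm),
        s.map ≫ eqToHom (congrArg ParObj.obj hN)⟩ := by
  subst hM hN
  simp

theorem isTotalObj_L (U : C) : IsTotalObj (L U) := ⟨L_L U, η_L U⟩

/-- The enlargement of an object of a local category, as an object of its restriction category
of partial morphisms. -/
abbrev enlargement (U : C) : ParObj C := ⟨L U, isTotalObj_L U⟩

/-- An object `U` with `L U = N`, regarded as the restriction idempotent `(U, η U)` on `N`. The
equality `L U = N` is kept as a hypothesis so that transport along equalities of objects reduces
to substitution. -/
def domain (U : C) (N : ParObj C) (h : L U = N.obj) : TotSplit (ParObj C) :=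
  ⟨N, cls ⟨U, h, η U ≫ eqToHom h⟩, rfl⟩

theorem domain_congr (U : C) {N P : ParObj C} (h : L U = N.obj) (k : L U = P.obj) :
    domain U N h = domain U P k := by
  have : N = P := by
    obtain ⟨_, _⟩ := N
    obtain ⟨_, _⟩ := P
    congr 1
    exact h.symm.trans k
  subst this
  rfl

theorem domain_total (N : ParObj C) (h : L N.obj = N.obj) :
    domain N.obj N h = ⟨N, 𝟙 N, res_id N⟩ := by
  refine TotSplit.ext rfl (heq_of_eq (congrArg cls ?_))
  exact congrArg (PSpan.mk N.obj h) (PSpan.graph_leg N.total (𝟙 _))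

/-- The total morphism `(U, f ≫ η V)` of the split completion induced by `f : U ⟶ V`. -/
def ofHom {U V : C} {N P : ParObj C} (hU : L U = N.obj) (hV : L V = P.obj) (f : U ⟶ V) :
    domain U N hU ⟶ domain V P hV :=
  TotSplit.Hom.mk (A := domain U N hU) (B := domain V P hV)
    (cls ⟨U, hU, f ≫ η V ≫ eqToHom hV⟩) rfl
    (cls_comp ⟨f, 𝟙 _, isPullback_mono f (η V ≫ eqToHom hV), Category.id_comp _, rfl⟩)

theorem ofHom_id {U : C} {N : ParObj C} (h : L U = N.obj) : ofHom h h (𝟙 U) = 𝟙 _ :=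
  TotSplit.hom_ext (congrArg (fun t => cls ⟨U, h, t⟩) (Category.id_comp _))

theorem ofHom_comp {U V W : C} {N P Q : ParObj C} (hU : L U = N.obj) (hV : L V = P.obj)
    (hW : L W = Q.obj) (f : U ⟶ V) (g : V ⟶ W) :
    ofHom hU hV f ≫ ofHom hV hW g = ofHom hU hW (f ≫ g) :=
  TotSplit.hom_ext (cls_comp ⟨f, 𝟙 _, isPullback_mono f (η V ≫ eqToHom hV),
    Category.id_comp _, (Category.assoc _ _ _).symm⟩)

theorem ofHom_congr {U V : C} {N N' P P' : ParObj C} (hU : L U = N.obj) (hV : L V = P.obj)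
    (hU' : L U = N'.obj) (hV' : L V = P'.obj) (f : U ⟶ V) :
    ofHom hU hV f = eqToHom (domain_congr U hU hU') ≫ ofHom hU' hV' f ≫
      eqToHom (domain_congr V hV' hV) := by
  have h₁ : N = N' := congrArg TotSplit.obj (domain_congr U hU hU')
  have h₂ : P = P' := congrArg TotSplit.obj (domain_congr V hV hV')
  subst h₁ h₂
  simp

theorem ofHom_injective {U V : C} {N P : ParObj C} (hU : L U = N.obj) (hV : L V = P.obj)
    {f g : U ⟶ V} (h : ofHom hU hV f = ofHom hU hV g) : f = g := by
  obtain ⟨φ, h1, h2⟩ := Quotient.exact (congrArg TotSplit.Hom.hom h)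
  have h1 : φ.hom ≫ η U ≫ eqToHom hU = η U ≫ eqToHom hU := h1
  have h2 : φ.hom ≫ g ≫ η V ≫ eqToHom hV = f ≫ η V ≫ eqToHom hV := h2
  have e : φ.hom = 𝟙 U := by
    rw [← cancel_mono (η U ≫ eqToHom hU), h1, Category.id_comp]
  rw [e, Category.id_comp] at h2
  exact ((cancel_mono _).1 h2).symm

/-- A total morphism `(U, η U) ⟶ (V, η V)` is represented by a span `s` with domain isomorphic to
`U`. Composing `s` with the idempotent of `V` pulls `η V` back along `s`; as this does not change the
class of `s`, the map of `s` factors through `η V`. -/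
theorem ofHom_surjective {U V : C} {N P : ParObj C} (hU : L U = N.obj) (hV : L V = P.obj)
    (k : domain U N hU ⟶ domain V P hV) : ∃ f : U ⟶ V, ofHom hU hV f = k := by
  obtain ⟨s, hs⟩ : ∃ s : PSpan N.obj P.obj, (cls s : N ⟶ P) = k.hom :=
    ⟨_, Quotient.out_eq k.hom⟩
  have hres := k.res_hom
  have hcomp := k.comp_idem
  rw [← hs] at hres hcomp
  obtain ⟨φ, h1, -⟩ : ∃ φ : s.dom ≅ U, φ.hom ≫ η U ≫ eqToHom hU = s.leg ∧ _ :=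
    Quotient.exact hres
  obtain ⟨w, p, m, sq, hm, hp⟩ := PSpan.exists_isComp s (⟨V, hV, η V ≫ eqToHom hV⟩ : PSpan _ _)
  obtain ⟨ψ, -, k2⟩ := Quotient.exact ((cls_comp ⟨p, m, sq, hm, hp⟩).symm.trans hcomp)
  have hp : p ≫ η V ≫ eqToHom hV = w.map := hp
  refine ⟨φ.inv ≫ ψ.inv ≫ p, TotSplit.hom_ext (Eq.trans (Quotient.sound ?_) hs)⟩
  refine ⟨φ.symm, ?_, ?_⟩
  · change φ.inv ≫ s.leg = η U ≫ eqToHom hU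
    rw [← h1, Iso.inv_hom_id_assoc]
  · change φ.inv ≫ s.map = (φ.inv ≫ ψ.inv ≫ p) ≫ η V ≫ eqToHom hV
    rw [Category.assoc, Category.assoc, hp, ← k2, Iso.inv_hom_id_assoc]

/-- Every restriction idempotent is of the form `(U, η U)`: an isomorphism between the spans
`(U, f)` and `(U, η U)` is the identity since `η U` is mono, whence `f = η U`. -/
theorem exists_domain_eq (A : TotSplit (ParObj C)) :
    ∃ (U : C) (h : L U = A.obj.obj), domain U A.obj h = A := by
  obtain ⟨N, a, ha⟩ := A
  obtain ⟨s, rfl⟩ : ∃ s : PSpan N.obj N.obj, (cls s : N ⟶ N) = a := ⟨_, Quotient.out_eq a⟩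
  obtain ⟨φ, h1, h2⟩ : ∃ φ : s.dom ≅ s.dom, φ.hom ≫ s.leg = s.leg ∧ φ.hom ≫ s.map = s.leg :=
    Quotient.exact ha
  have e : φ.hom = 𝟙 s.dom := by
    rw [← cancel_mono s.leg, Category.id_comp, h1]
  have e' : s.map = s.leg := by
    rwa [e, Category.id_comp] at h2
  refine ⟨s.dom, s.L_dom, TotSplit.ext rfl (heq_of_eq (congrArg cls ?_))⟩
  exact congrArg (PSpan.mk s.dom s.L_dom) e'.symm

/-- The identifications of objects made by the unit. -/
theorem domain_eq_iff {U V : C} : domain U (enlargement U) rfl = domain V (enlargement V) rfl ↔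
    ∃ (h : L U = L V) (φ : U ≅ V), φ.hom ≫ η V = η U ≫ eqToHom h := by
  have key : ∀ {N : ParObj C} (hU : L U = N.obj) (hV : L V = N.obj),
      domain U N hU = domain V N hV ↔
        ∃ φ : U ≅ V, φ.hom ≫ η V ≫ eqToHom hV = η U ≫ eqToHom hU := by
    intro N hU hV
    constructor
    · intro e
      have e' : (domain U N hU).idem = (domain V N hV).idem := by
        unfold domain at e
        injection e
      obtain ⟨φ, h, -⟩ := Quotient.exact e'
      exact ⟨φ, h⟩
    · rintro ⟨φ, h⟩
      exact TotSplit.ext rfl (heq_of_eq (Quotient.sound ⟨φ, h, h⟩))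
  constructor
  · intro e
    have h : L U = L V := congrArg (fun A : TotSplit (ParObj C) => A.obj.obj) e
    obtain ⟨φ, hφ⟩ := (key (N := enlargement V) h rfl).1 ((domain_congr U _ _).trans e)
    exact ⟨h, φ, by simpa using hφ⟩
  · rintro ⟨h, φ, hφ⟩
    exact (domain_congr U _ _).trans ((key (N := enlargement V) h rfl).2 ⟨φ, by simpa using hφ⟩)

variable (C) in
/-- The functor `U ↦ (L U, (U, η U))`, `f ↦ (U, f ≫ η V)` underlying the unit. -/
def toTotSplit : C ⥤ TotSplit (ParObj C) where
  obj U := domain U (enlargement U) rfl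
  map f := ofHom _ _ f
  map_id _ := ofHom_id _
  map_comp _ _ := (ofHom_comp _ _ _ _ _).symm

instance : (toTotSplit C).Faithful where
  map_injective h := ofHom_injective _ _ h

instance : (toTotSplit C).Full where
  map_surjective k := ofHom_surjective _ _ k

theorem toTotSplit_obj_surjective : Function.Surjective (toTotSplit C).obj := fun A => by
  obtain ⟨U, h, e⟩ := exists_domain_eq A
  exact ⟨U, (domain_congr U _ _).trans e⟩

instance : (toTotSplit C).EssSurj where
  mem_essImage A := by
    obtain ⟨U, e⟩ := toTotSplit_obj_surjective A
    exact ⟨U, ⟨eqToIso e⟩⟩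

instance : (toTotSplit C).IsEquivalence where

theorem toTotSplit_obj_L (U : C) : (toTotSplit C).obj (L U) = L ((toTotSplit C).obj U) :=
  (domain_congr (L U) (P := enlargement U) rfl (L_L U)).trans (domain_total (enlargement U) _)

/-- Both sides are represented by the span `(U, η U)`, up to the identification of `L (L U)` with
`L U`. -/
theorem toTotSplit_map_η (U : C) : (toTotSplit C).map (η U) =
    η ((toTotSplit C).obj U) ≫ eqToHom (toTotSplit_obj_L U).symm := by
  have h : ofHom (N := enlargement U) (P := enlargement U) rfl (L_L U) (η U) =
      TotSplit.incl (domain U (enlargement U) rfl) ≫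
        eqToHom (domain_total (enlargement U) (L_L U)).symm := by
    apply TotSplit.hom_ext
    rw [TotSplit.comp_hom]
    refine Eq.trans ?_ (congrArg (fun t => _ ≫ t) (TotSplit.eqToHom_hom _).symm)
    refine Eq.trans ?_ (Category.comp_id _).symm
    have e : η U ≫ η (L U) ≫ eqToHom (L_L U) = η U ≫ eqToHom rfl := by
      rw [η_L, eqToHom_trans]
    exact congrArg (fun t => cls ⟨U, rfl, t⟩) e
  refine (ofHom_congr (N := enlargement U) (P := enlargement (L U)) (N' := enlargement U)
    (P' := enlargement U) rfl rfl rfl (L_L U) (η U)).trans ?_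
  rw [h, eqToHom_refl, Category.id_comp, Category.assoc]
  exact congrArg (fun t => TotSplit.incl (domain U (enlargement U) rfl) ≫ t) (eqToHom_trans _ _)

/-- The component of the unit: a local functor from a local category to the total category of the
split completion of its category of partial morphisms. -/
def unit (C : Type u) [Category.{u} C] [LocalStructure C] :
    LocalFunctor C (TotSplit (ParObj C)) where
  toFunctor := toTotSplit C
  obj_L := toTotSplit_obj_L
  map_η := toTotSplit_map_η
  map_pullback sq := sq.map _

end ParObj

theorem η_comp_eqToHom {M N : C} (h : M = N) :
    η M ≫ eqToHom (congrArg L h) = eqToHom h ≫ η N := by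
  subst h
  simp

/-! ### Strict sections of local equivalences -/

/-- A section on objects of a fully faithful functor, such that the section commutes with
enlargements, underlies a local functor. -/
def LocalFunctor.ofSection (F : LocalFunctor C D) [F.Full] [F.Faithful] [F.EssSurj]
    (s : D → C) (hs : ∀ A, F.obj (s A) = A) (hL : ∀ A, s (L A) = L (s A)) : LocalFunctor D C :=
  let G : D ⥤ C :=
    { obj := s
      map := fun {A B} f => F.preimage (eqToHom (hs A) ≫ f ≫ eqToHom (hs B).symm)
      map_id := fun A => F.map_injective (by simp)
      map_comp := fun f g => F.map_injective (by simp) }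
  { toFunctor := G
    obj_L := hL
    map_η := fun A => F.map_injective (by
      rw [F.map_comp, F.map_η, eqToHom_map, Category.assoc, eqToHom_trans]
      refine (F.map_preimage _).trans ?_
      rw [← Category.assoc, ← η_comp_eqToHom, Category.assoc, eqToHom_trans])
    map_pullback := by
      have : F.toFunctor.IsEquivalence := { }
      -- `G` followed by `F` is the identity up to transport, so `G` is an equivalence as well.
      have : (G ⋙ F.toFunctor).IsEquivalence :=
        Functor.isEquivalence_of_iso (F := 𝟭 D)
          (NatIso.ofComponents (fun A => eqToIso (hs A).symm) (fun {A B} f => by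
            simp [G]))
      have : G.IsEquivalence := Functor.isEquivalence_of_comp_right G F.toFunctor
      intro P M N p m f sq
      exact sq.map G }

theorem LocalFunctor.map_ofSection (F : LocalFunctor C D) [F.Full] [F.Faithful] [F.EssSurj]
    (s : D → C) (hs : ∀ A, F.obj (s A) = A) (hL : ∀ A, s (L A) = L (s A)) {A B : D} (f : A ⟶ B) :
    F.map ((F.ofSection s hs hL).map f) = eqToHom (hs A) ≫ f ≫ eqToHom (hs B).symm :=
  F.map_preimage _

theorem LocalFunctor.ofSection_comp (F : LocalFunctor C D) [F.Full] [F.Faithful] [F.EssSurj]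
    (s : D → C) (hs : ∀ A, F.obj (s A) = A) (hL : ∀ A, s (L A) = L (s A)) :
    (F.ofSection s hs hL).comp F = LocalFunctor.id D :=
  LocalFunctor.ext_functor (CategoryTheory.Functor.ext hs
    (fun _ _ f => F.map_ofSection s hs hL f))

/-- A natural isomorphism between the functors underlying local functors is an isomorphism of local
functors. -/
def LocalFunctor.isoOfNatIso {F G : LocalFunctor C D} (e : F.toFunctor ≅ G.toFunctor) : F ≅ G where
  hom := LocalTrans.mk (fun M => e.hom.app M) (fun f => e.hom.naturality f)
  inv := LocalTrans.mk (fun M => e.inv.app M) (fun f => e.inv.naturality f)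
  hom_inv_id := LocalTrans.hom_ext (fun M => e.hom_inv_id_app M)
  inv_hom_id := LocalTrans.hom_ext (fun M => e.inv_hom_id_app M)

/-- When `s` is a section of `F` on objects, `F` followed by the functor underlying `s` is isomorphic
to the identity. -/
def LocalFunctor.compOfSectionIso (F : LocalFunctor C D) [F.Full] [F.Faithful] [F.EssSurj]
    (s : D → C) (hs : ∀ A, F.obj (s A) = A) (hL : ∀ A, s (L A) = L (s A)) :
    F.comp (F.ofSection s hs hL) ≅ LocalFunctor.id C :=
  LocalFunctor.isoOfNatIso (show F.toFunctor ⋙ (F.ofSection s hs hL).toFunctor ≅ 𝟭 C from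
    NatIso.ofComponents (fun M => F.preimageIso (eqToIso (hs (F.obj M)))) 
      (fun {M N} f => F.map_injective (by
        rw [F.map_comp, F.map_comp]
        exact (congrArg₂ (· ≫ ·) (F.map_ofSection s hs hL (F.map f)) (F.map_preimage _)).trans
          ((eqToHom_comp_comp_eqToHom_comp_eqToHom _ _ _ (hs (F.obj N))).trans
            (congrArg (fun t => t ≫ F.map f) (F.map_preimage _).symm)))))

/-! ### Inverting the unit -/

namespace ParObj

instance : (unit C).Full := inferInstanceAs (toTotSplit C).Full
instance : (unit C).Faithful := inferInstanceAs (toTotSplit C).Faithful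
instance : (unit C).EssSurj := inferInstanceAs (toTotSplit C).EssSurj

open Classical in
/-- A section of the unit on objects. Over the total object `(M, 𝟙 M)` it must take the value `M`,
so that it commutes with enlargements strictly. -/
def domainSection (A : TotSplit (ParObj C)) : C :=
  if A.idem = 𝟙 A.obj then A.obj.obj else (exists_domain_eq A).choose

theorem domainSection_spec (A : TotSplit (ParObj C)) :
    ∃ h : L (domainSection A) = A.obj.obj, domain (domainSection A) A.obj h = A := by
  unfold domainSection
  split_ifs with h
  · exact ⟨A.obj.total.choose, (domain_total A.obj _).trans (TotSplit.ext rfl (heq_of_eq h.symm))⟩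
  · exact (exists_domain_eq A).choose_spec

theorem unit_obj_domainSection (A : TotSplit (ParObj C)) : (unit C).obj (domainSection A) = A :=
  (domain_congr _ _ _).trans (domainSection_spec A).choose_spec

theorem domainSection_L (A : TotSplit (ParObj C)) : domainSection (L A) = L (domainSection A) :=
  (if_pos rfl).trans (domainSection_spec A).choose.symm

/-- The values of the two composites `F ≫ unit` and `unit ≫ L[R[F]]` at `U`: the second one is the
domain `F U` over `F (L U)` instead of `L (F U)`. -/
theorem domain_map_enlargement (F : LocalFunctor C D) (U : C) :
    domain (F.obj U) ((ParObj.map F).obj (enlargement U)) (F.obj_L U).symm =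
      (TotSplit.map (ParObj.map F)).obj ((unit C).obj U) := by
  refine TotSplit.ext rfl (heq_of_eq ?_)
  have e : η (F.obj U) ≫ eqToHom (F.obj_L U).symm = F.map (η U ≫ eqToHom rfl) := by
    rw [← F.map_η, eqToHom_refl, Category.comp_id]
  exact congrArg (fun t => cls ⟨F.obj U, (F.obj_L U).symm, t⟩) e

/-- The unit is strictly natural in local functors. -/
theorem comp_unit (F : LocalFunctor C D) :
    F.comp (unit D) = (unit C).comp (TotSplit.map (ParObj.map F)) := by
  refine LocalFunctor.ext_functor (CategoryTheory.Functor.ext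
    (fun U => (domain_congr _ rfl (F.obj_L U).symm).trans (domain_map_enlargement F U))
    (fun U V f => ?_))
  refine (ofHom_congr (N := enlargement _) (P := enlargement _)
    (N' := (ParObj.map F).obj (enlargement U)) (P' := (ParObj.map F).obj (enlargement V))
    rfl rfl (F.obj_L U).symm (F.obj_L V).symm (F.map f)).trans ?_
  have h : ofHom (N := (ParObj.map F).obj (enlargement U))
        (P := (ParObj.map F).obj (enlargement V)) (F.obj_L U).symm (F.obj_L V).symm (F.map f) =
      eqToHom (domain_map_enlargement F U) ≫ (TotSplit.map (ParObj.map F)).map ((unit C).map f) ≫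
        eqToHom (domain_map_enlargement F V).symm := by
    apply TotSplit.hom_ext
    refine Eq.trans ?_ (TotSplit.eqToHom_comp_comp_eqToHom_hom _ _ _).symm
    refine Eq.trans ?_ ((Category.id_comp _).trans (Category.comp_id _)).symm
    have e : F.map f ≫ η (F.obj V) ≫ eqToHom (F.obj_L V).symm = F.map (f ≫ η V ≫ eqToHom rfl) := by
      rw [← F.map_η, ← F.map_comp, eqToHom_refl, Category.comp_id]
    exact congrArg (fun t => cls ⟨F.obj U, (F.obj_L U).symm, t⟩) e
  rw [h]
  simp only [Category.assoc, eqToHom_trans, eqToHom_trans_assoc]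
  rfl

end ParObj
end

/-! ### The counit -/

section

variable {X Y : Type u} [Category.{u} X] [RestrictionStructure X]
  [Category.{u} Y] [RestrictionStructure Y]

namespace TotSplit

theorem isTotalObj_iff (M : TotSplit X) : IsTotalObj M ↔ M.idem = 𝟙 M.obj := by
  obtain ⟨A, a, ha⟩ := M
  constructor
  · rintro ⟨h, -⟩
    have h' : (⟨A, 𝟙 A, res_id A⟩ : TotSplit X) = ⟨A, a, ha⟩ := h
    injection h' with _ h'
    exact h'.symm
  · rintro h
    have h : a = 𝟙 A := h
    subst h
    exact ⟨rfl, rfl⟩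

/-- The object `(A, 𝟙 A)` as an object of the category of partial morphisms. -/
def ofObj (A : X) : ParObj (TotSplit X) := ⟨⟨A, 𝟙 A, res_id A⟩, rfl, rfl⟩

theorem exists_ofObj_eq (M : ParObj (TotSplit X)) : ∃ A : X, ofObj A = M := by
  obtain ⟨⟨A, a, ha⟩, hM⟩ := M
  have h : a = 𝟙 A := (isTotalObj_iff _).1 hM
  subst h
  exact ⟨A, rfl⟩

/-- The span `(A, res f) ⟶ (B, 𝟙 B)` representing a morphism `f : A ⟶ B`. -/
def spanOf {A B : X} (f : A ⟶ B) : PSpan (ofObj A).obj (ofObj B).obj :=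
  ⟨⟨A, res f, res_res f⟩, rfl,
    TotSplit.Hom.mk (A := ⟨A, res f, res_res f⟩) (B := ⟨B, 𝟙 B, res_id B⟩) f rfl
      (Category.comp_id f)⟩

theorem exists_spanOf_eq {A B : X} (s : PSpan (ofObj A).obj (ofObj B).obj) :
    ∃ f : A ⟶ B, spanOf f = s := by
  obtain ⟨⟨o, a, ha⟩, h, f, hf, hf'⟩ := s
  have h' : (⟨o, 𝟙 o, res_id o⟩ : TotSplit X) = ⟨A, 𝟙 A, res_id A⟩ := h
  injection h' with h'
  subst h'
  have key : ∀ (f : o ⟶ B) (h : res f = a) (h' : f ≫ 𝟙 B = f), spanOf f =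
      ⟨⟨o, a, ha⟩, rfl, TotSplit.Hom.mk (A := ⟨o, a, ha⟩) (B := ⟨B, 𝟙 B, res_id B⟩) f h h'⟩ := by
    intro f h h'
    subst h
    rfl
  exact ⟨f, key f hf hf'⟩

/-- Isomorphic spans `(res f, f)` and `(res g, g)` give `res f ≫ g = f` and `res g ≫ f = g`, so that
`f` and `g` agree because restriction idempotents commute. -/
theorem spanOf_rel {A B : X} {f g : A ⟶ B} (h : spanOf f ≈ spanOf g) : f = g := by
  have key : ∀ {f g : A ⟶ B}, spanOf f ≈ spanOf g → res f ≫ g = f := by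
    rintro f g ⟨φ, h1, h2⟩
    have key' : ∀ k : A ⟶ A, k ≫ res g ≫ 𝟙 A = res f ≫ 𝟙 A → k ≫ g = f → k ≫ res g = k →
        res f ≫ g = f := fun k h1 h2 h3 => by
      rw [Category.comp_id, Category.comp_id, h3] at h1
      rw [← h1, h2]
    exact key' φ.hom.hom (congrArg TotSplit.Hom.hom h1) (congrArg TotSplit.Hom.hom h2)
      φ.hom.comp_idem
  have h₁ := key h
  have h₂ := key (Setoid.symm h)
  calc f = res f ≫ res g ≫ f := by rw [h₂, h₁]
    _ = res g ≫ res f ≫ f := by rw [← Category.assoc, res_comm, Category.assoc]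
    _ = g := by rw [res_comp_self, h₂]

/-- The morphism of `X` underlying a span. As `L U = M` holds only propositionally, the map of the span
is precomposed with a transport. -/
def spanHom {M N : TotSplit X} (s : PSpan M N) : M.obj ⟶ N.obj :=
  eqToHom (show M.obj = s.dom.obj from (congrArg TotSplit.obj s.L_dom).symm) ≫
    TotSplit.Hom.hom s.map

theorem spanHom_spanOf {A B : X} (f : A ⟶ B) : spanHom (spanOf f) = f :=
  Category.id_comp (X := A) (Y := B) f

theorem spanOf_spanHom {A B : X} (s : PSpan (ofObj A).obj (ofObj B).obj) :
    spanOf (A := A) (B := B) (spanHom s) = s := by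
  obtain ⟨f, rfl⟩ := exists_spanOf_eq s
  exact congrArg spanOf (spanHom_spanOf f)

theorem isComp_spanOf {A B C : X} (f : A ⟶ B) (g : B ⟶ C) :
    PSpan.IsComp (spanOf f) (spanOf g) (spanOf (f ≫ g)) := by
  have e : res (f ≫ g) ≫ res f = res (f ≫ g) := by
    rw [res_comm, res_res_comp, ← Category.assoc, res_comp_self]
  have e' : f ≫ res g ≫ g = f ≫ g := by rw [res_comp_self]
  have hleg : (spanOf g).leg = TotSplit.incl _ := Category.comp_id _
  refine ⟨TotSplit.Hom.mk (A := (spanOf (f ≫ g)).dom) (B := (spanOf g).dom) (f ≫ res g)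
      (res_comp_res f g) ?_,
    TotSplit.Hom.mk (A := (spanOf (f ≫ g)).dom) (B := (spanOf f).dom) (res (f ≫ g))
      (res_res _) e, ?_, TotSplit.hom_ext ?_, TotSplit.hom_ext ?_⟩
  · exact (Category.assoc _ _ _).trans (congrArg (fun t => f ≫ t) (Partiality.res_idem g))
  · rw [hleg]
    refine TotSplit.isPullback (A := (spanOf g).dom) (spanOf f).map _ _ _ (res (f ≫ g)) ?_ ?_ ?_ ?_
    · exact (res_res _).trans (res_comp_res f g).symm
    · exact (Partiality.res_idem _).trans (res_comp_res f g).symm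
    · exact Partiality.res_idem _
    · exact comp_res f g
  · exact (congrArg (fun t => res (f ≫ g) ≫ t) (Category.comp_id (res f))).trans
      (e.trans (Category.comp_id _).symm)
  · exact (Category.assoc _ _ _).trans e'

/-- The inverse of the component of the counit: `f` is sent to the span `(res f, f)`. -/
def ofRestriction (X : Type u) [Category.{u} X] [RestrictionStructure X] :
    RestrictionFunctor X (ParObj (TotSplit X)) where
  obj := ofObj
  map f := ParObj.cls (spanOf f)
  map_id A := by
    refine Eq.trans (congrArg ParObj.cls ?_) (ParObj.cls_graph_id (ofObj A))
    refine Eq.trans ?_ (spanOf_spanHom _)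
    exact congrArg spanOf (Category.id_comp (𝟙 A)).symm
  map_comp f g := (ParObj.cls_comp (isComp_spanOf f g)).symm
  map_res f := by
    refine congrArg ParObj.cls (Eq.trans ?_ (spanOf_spanHom _))
    exact congrArg spanOf ((Category.id_comp _).trans (Category.comp_id _)).symm

theorem ofRestriction_map_surjective {A B : X} (k : ofObj A ⟶ ofObj B) :
    ∃ f : A ⟶ B, (ofRestriction X).map f = k := by
  induction k using ParObj.ind with | _ s
  obtain ⟨f, rfl⟩ := exists_spanOf_eq s
  exact ⟨f, rfl⟩

/-- The component of the counit: `(A, 𝟙 A)` is sent to `A`, and a span `(U, f)` to `f`. -/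
def counit (X : Type u) [Category.{u} X] [RestrictionStructure X] :
    RestrictionFunctor (ParObj (TotSplit X)) X where
  obj M := M.obj.obj
  map {M N} k := Quotient.lift (spanHom (M := M.obj) (N := N.obj)) (fun s t h => by
    obtain ⟨A, rfl⟩ := exists_ofObj_eq M
    obtain ⟨B, rfl⟩ := exists_ofObj_eq N
    obtain ⟨f, rfl⟩ := exists_spanOf_eq s
    obtain ⟨g, rfl⟩ := exists_spanOf_eq t
    rw [spanOf_rel h]) k
  map_id M := by
    exact (Category.id_comp _).trans ((TotSplit.isTotalObj_iff M.obj).1 M.total)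
  map_comp {M N P} k l := by
    obtain ⟨A, rfl⟩ := exists_ofObj_eq M
    obtain ⟨B, rfl⟩ := exists_ofObj_eq N
    obtain ⟨C, rfl⟩ := exists_ofObj_eq P
    obtain ⟨f, rfl⟩ := ofRestriction_map_surjective k
    obtain ⟨g, rfl⟩ := ofRestriction_map_surjective l
    have h := (ofRestriction X).map_comp f g
    refine (congrArg (Quotient.lift _ _) h.symm).trans ?_
    exact (spanHom_spanOf (f ≫ g)).trans
      (congrArg₂ (· ≫ ·) (spanHom_spanOf f) (spanHom_spanOf g)).symm
  map_res {M N} k := by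
    obtain ⟨A, rfl⟩ := exists_ofObj_eq M
    obtain ⟨B, rfl⟩ := exists_ofObj_eq N
    obtain ⟨f, rfl⟩ := ofRestriction_map_surjective k
    have h := (ofRestriction X).map_res f
    refine (congrArg (Quotient.lift _ _) h.symm).trans ?_
    exact (spanHom_spanOf (res f)).trans (congrArg res (spanHom_spanOf f)).symm

theorem ofRestriction_comp_counit :
    (ofRestriction X).comp (counit X) = RestrictionFunctor.id X :=
  RestrictionFunctor.ext_functor (CategoryTheory.Functor.ext (fun _ => rfl) (fun _ _ f =>
    (spanHom_spanOf f).trans ((Category.id_comp _).trans (Category.comp_id _)).symm))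

theorem counit_comp_ofRestriction :
    (counit X).comp (ofRestriction X) = RestrictionFunctor.id _ := by
  refine RestrictionFunctor.ext_functor (CategoryTheory.Functor.ext (fun M => ?_) (fun M N k => ?_))
  · obtain ⟨A, rfl⟩ := exists_ofObj_eq M
    rfl
  · obtain ⟨A, rfl⟩ := exists_ofObj_eq M
    obtain ⟨B, rfl⟩ := exists_ofObj_eq N
    obtain ⟨f, rfl⟩ := ofRestriction_map_surjective k
    refine Eq.trans ?_ ((Category.id_comp _).trans (Category.comp_id _)).symm
    exact congrArg (ofRestriction X).map (spanHom_spanOf f)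

/-- The counit is strictly natural in restriction functors. -/
theorem comp_counit (F : RestrictionFunctor X Y) :
    (ParObj.map (TotSplit.map F)).comp (counit Y) = (counit X).comp F := by
  refine RestrictionFunctor.ext_functor (CategoryTheory.Functor.ext (fun M => rfl)
    (fun M N k => ?_))
  obtain ⟨A, rfl⟩ := exists_ofObj_eq M
  obtain ⟨B, rfl⟩ := exists_ofObj_eq N
  obtain ⟨f, rfl⟩ := ofRestriction_map_surjective k
  refine Eq.trans ?_ ((Category.id_comp _).trans (Category.comp_id _)).symm
  refine Eq.trans ?_ (congrArg (fun t => F.map t) (spanHom_spanOf f).symm)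
  exact Category.id_comp _

end TotSplit
end

/-! ### Naturality for 2-cells and the triangle identities -/

section

variable {C D : Type u} [Category.{u} C] [LocalStructure C] [Category.{u} D] [LocalStructure D]
  {X Y : Type u} [Category.{u} X] [RestrictionStructure X] [Category.{u} Y] [RestrictionStructure Y]

/-- The unit is strictly natural in local natural transformations. -/
theorem ParObj.unit_naturality₂ {F G : LocalFunctor C D} (α : F ⟶ G) :
    LocalTrans.whiskerRight α (ParObj.unit D) ≫ eqToHom (ParObj.comp_unit G) =
      eqToHom (ParObj.comp_unit F) ≫
        LocalTrans.whiskerLeft (ParObj.unit C) (TotSplit.map₂ (ParObj.map₂ α)) := by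
  apply LocalTrans.hom_ext
  intro U
  rw [LocalTrans.comp_app, LocalTrans.comp_app, LocalTrans.eqToHom_app, LocalTrans.eqToHom_app]
  have h : ofHom (N := (ParObj.map F).obj (enlargement U))
        (P := (ParObj.map G).obj (enlargement U)) (F.obj_L U).symm (G.obj_L U).symm
        (LocalTrans.app α U) =
      eqToHom (domain_map_enlargement F U) ≫
        (TotSplit.map₂ (ParObj.map₂ α)).app ((ParObj.unit C).obj U) ≫
        eqToHom (domain_map_enlargement G U).symm := by
    apply TotSplit.hom_ext
    refine Eq.trans ?_ (TotSplit.eqToHom_comp_comp_eqToHom_hom _ _ _).symm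
    refine Eq.trans ?_ ((Category.id_comp _).trans (Category.comp_id _)).symm
    refine Eq.trans ?_ (ParObj.cls_comp (PSpan.isComp_graph_right _ _ _)).symm
    have e : LocalTrans.app α U ≫ η (G.obj U) ≫ eqToHom (G.obj_L U).symm =
        F.map (η U ≫ eqToHom rfl) ≫ LocalTrans.app α (L U) := by
      rw [← G.map_η, ← LocalTrans.naturality, eqToHom_refl, Category.comp_id]
    exact congrArg (fun t => cls ⟨F.obj U, (F.obj_L U).symm, t⟩) e
  have h' := (ofHom_congr (N := enlargement _) (P := enlargement _)
    (N' := (ParObj.map F).obj (enlargement U)) (P' := (ParObj.map G).obj (enlargement U))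
    rfl rfl (F.obj_L U).symm (G.obj_L U).symm (LocalTrans.app α U))
  rw [h] at h'
  refine (congrArg (fun t : (ParObj.unit D).obj (F.obj U) ⟶ (ParObj.unit D).obj (G.obj U) =>
    t ≫ eqToHom _) h').trans ?_
  simp only [Category.assoc, eqToHom_trans, eqToHom_trans_assoc]
  exact eqToHom_comp_comp_eqToHom_comp_eqToHom _ _ _ _

theorem TotSplit.counit_naturality₂ {F G : RestrictionFunctor X Y} (α : F ⟶ G) :
    RestrictionTrans.whiskerRight (ParObj.map₂ (TotSplit.map₂ α)) (TotSplit.counit Y) ≫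
        eqToHom (TotSplit.comp_counit G) =
      eqToHom (TotSplit.comp_counit F) ≫ RestrictionTrans.whiskerLeft (TotSplit.counit X) α := by
  apply RestrictionTrans.hom_ext
  intro M
  rw [RestrictionTrans.comp_app, RestrictionTrans.comp_app, RestrictionTrans.eqToHom_app,
    RestrictionTrans.eqToHom_app]
  refine (Category.comp_id _).trans (Eq.trans ?_ (Category.id_comp _).symm)
  refine (Category.id_comp _).trans ?_
  obtain ⟨A, rfl⟩ := exists_ofObj_eq M
  exact (congrArg (fun t => t ≫ _) (F.map_id A)).trans (Category.id_comp _)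

/-- An inverse equivalence of the unit. -/
def ParObj.unitInverse (C : Type u) [Category.{u} C] [LocalStructure C] :
    LocalFunctor (TotSplit (ParObj C)) C :=
  (ParObj.unit C).ofSection domainSection unit_obj_domainSection domainSection_L

/-- The unit followed by `unitInverse` is isomorphic, not necessarily equal, to the identity. -/
def ParObj.unitCompUnitInverseIso (C : Type u) [Category.{u} C] [LocalStructure C] :
    (ParObj.unit C).comp (ParObj.unitInverse C) ≅ LocalFunctor.id C :=
  LocalFunctor.compOfSectionIso _ _ _ _

theorem ParObj.unitInverse_comp_unit (C : Type u) [Category.{u} C] [LocalStructure C] :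
    (ParObj.unitInverse C).comp (ParObj.unit C) = LocalFunctor.id _ :=
  LocalFunctor.ofSection_comp _ _ _ _

theorem ParObj.unit_comp_unitInverse (hinj : Function.Injective (ParObj.unit C).obj) :
    (ParObj.unit C).comp (ParObj.unitInverse C) = LocalFunctor.id C := by
  refine LocalFunctor.ext_functor (CategoryTheory.Functor.ext
    (fun U => hinj (unit_obj_domainSection _)) (fun U V f => ?_))
  apply (ParObj.unit C).map_injective
  refine (LocalFunctor.map_ofSection _ _ _ domainSection_L _).trans ?_
  rw [Functor.map_comp, Functor.map_comp, eqToHom_map, eqToHom_map]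
  rfl

/-- The triangle identity at the category of partial morphisms. On objects it sends `M` to `L M`,
which equals `M` because `M` is total. -/
theorem ParObj.map_unit_comp_counit :
    (ParObj.map (ParObj.unit C)).comp (TotSplit.counit (ParObj C)) =
      RestrictionFunctor.id (ParObj C) := by
  have hobj : ∀ M : ParObj C, enlargement M.obj = M := fun M => by
    obtain ⟨M, hM⟩ := M
    unfold enlargement
    congr 1
    exact hM.choose
  refine RestrictionFunctor.ext_functor (CategoryTheory.Functor.ext hobj (fun M N k => ?_))
  induction k using ParObj.ind with | _ s
  refine Eq.trans ?_ (eqToHom_comp_cls_comp_eqToHom (hobj M) (hobj N).symm s).symm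
  have h : enlargement M.obj = enlargement s.dom := by
    unfold enlargement
    congr 1
    exact M.total.choose.trans s.L_dom.symm
  refine (congrArg (fun t : enlargement s.dom ⟶ enlargement N.obj => eqToHom h ≫ t)
    (Category.comp_id _).symm).trans ?_
  refine (eqToHom_comp_cls_comp_eqToHom (M := enlargement s.dom) (N := enlargement N.obj)
    h rfl ⟨s.dom, rfl, s.map ≫ η N.obj ≫ eqToHom rfl⟩).trans ?_
  obtain ⟨hN, hN'⟩ := N.total
  have e' : (s.map ≫ η N.obj ≫ eqToHom rfl) ≫ 𝟙 _ = s.map ≫ eqToHom hN.symm := by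
    rw [hN', Category.comp_id, eqToHom_refl, Category.comp_id]
  exact congrArg (fun t => cls ⟨s.dom, _, t⟩) e'

/-- The triangle identity at the split completion: `(A, a)` is sent to the span `((A, a), a)` and back
to `(A, a)`. -/
theorem TotSplit.unit_comp_map_counit :
    (ParObj.unit (TotSplit X)).comp (TotSplit.map (TotSplit.counit X)) =
      LocalFunctor.id (TotSplit X) := by
  have hobj : ∀ A : TotSplit X, (TotSplit.map (TotSplit.counit X)).obj
      ((ParObj.unit (TotSplit X)).obj A) = A := fun A =>
    TotSplit.ext rfl (heq_of_eq ((Category.id_comp _).trans (Category.comp_id _)))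
  refine LocalFunctor.ext_functor (CategoryTheory.Functor.ext hobj (fun A B f => ?_))
  apply TotSplit.hom_ext
  refine Eq.trans ?_ (TotSplit.eqToHom_comp_comp_eqToHom_hom _ _ _).symm
  refine Eq.trans ?_ ((Category.id_comp _).trans (Category.comp_id _)).symm
  refine (Category.id_comp _).trans ?_
  exact (congrArg (fun t => TotSplit.Hom.hom f ≫ t) (Category.comp_id _)).trans
    (TotSplit.Hom.comp_idem f)

end

/-! ### Restricting 2-equivalences to classes of 2-cells -/

section

variable {B : Type u₁} [Bicategory.{w₁, v₁} B] [Bicategory.Strict B]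
  {B' : Type u₂} [Bicategory.{w₂, v₂} B'] [Bicategory.Strict B']
  {W : TwoCellClass B} {W' : TwoCellClass B'}

theorem IsIso₁.isEquivalence₁ {a b : B} {f : a ⟶ b} (h : IsIso₁ f) : IsEquivalence₁ f := by
  obtain ⟨g, h₁, h₂⟩ := h
  exact ⟨g, ⟨eqToIso h₁⟩, ⟨eqToIso h₂⟩⟩

/-- A 2-equivalence restricts to classes of 2-cells preserved by both 2-functors, provided that the
components of the unit and the counit are still equivalences. -/
def TwoEquivalence.restrict {F : StrictPseudofunctor B B'} {G : StrictPseudofunctor B' B}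
    (e : TwoEquivalence F G)
    (hF : ∀ {a b : B} {f g : a ⟶ b} (α : f ⟶ g), W.mem α → W'.mem (F.map₂ α))
    (hG : ∀ {a b : B'} {f g : a ⟶ b} (α : f ⟶ g), W'.mem α → W.mem (G.map₂ α))
    (hunit : ∀ a : W.Sub, IsEquivalence₁ (B := W.Sub) (a := a) (b := ⟨G.obj (F.obj a.obj)⟩)
      (TwoCellClass.Hom₁.mk (e.unit.app a.obj)))
    (hcounit : ∀ b : W'.Sub, IsEquivalence₁ (B := W'.Sub) (a := ⟨F.obj (G.obj b.obj)⟩) (b := b)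
      (TwoCellClass.Hom₁.mk (e.counit.app b.obj))) :
    TwoEquivalence (TwoCellClass.restrict F hF) (TwoCellClass.restrict G hG) where
  unit :=
    { app := fun a => ⟨e.unit.app a.obj⟩
      naturality := fun f => TwoCellClass.hom_ext _ (e.unit.naturality f.hom)
      naturality₂ := fun α => TwoCellClass.hom₂_ext _ (by
        rw [TwoCellClass.comp_hom₂, TwoCellClass.comp_hom₂, TwoCellClass.eqToHom_hom₂,
          TwoCellClass.eqToHom_hom₂]
        exact e.unit.naturality₂ α.hom) }
  counit :=
    { app := fun b => ⟨e.counit.app b.obj⟩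
      naturality := fun f => TwoCellClass.hom_ext _ (e.counit.naturality f.hom)
      naturality₂ := fun α => TwoCellClass.hom₂_ext _ (by
        rw [TwoCellClass.comp_hom₂, TwoCellClass.comp_hom₂, TwoCellClass.eqToHom_hom₂,
          TwoCellClass.eqToHom_hom₂]
        exact e.counit.naturality₂ α.hom) }
  left_triangle a := TwoCellClass.hom_ext _ (e.left_triangle a.obj)
  right_triangle b := TwoCellClass.hom_ext _ (e.right_triangle b.obj)
  unit_equivalence := hunit
  counit_equivalence := hcounit

theorem TwoCellClass.isEquivalence₁_mk {a b : W.Sub} {f : a.obj ⟶ b.obj} (h : IsEquivalence₁ f)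
    (hW : ∀ {a b : B} {f g : a ⟶ b} (α : f ≅ g), W.mem α.hom) :
    IsEquivalence₁ (a := a) (b := b) (TwoCellClass.Hom₁.mk f) := by
  obtain ⟨g, ⟨α⟩, ⟨β⟩⟩ := h
  have lift : ∀ {a b : W.Sub} {f g : a ⟶ b}, (f.hom ≅ g.hom) → Nonempty (f ≅ g) := fun α =>
    ⟨{ hom := ⟨α.hom, hW α⟩
       inv := ⟨α.inv, hW α.symm⟩
       hom_inv_id := TwoCellClass.hom₂_ext _ α.hom_inv_id
       inv_hom_id := TwoCellClass.hom₂_ext _ α.inv_hom_id }⟩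
  exact ⟨⟨g⟩, lift α, lift β⟩

theorem TwoCellClass.isIso₁_mk {a b : W.Sub} {f : a.obj ⟶ b.obj} (h : IsIso₁ f) :
    IsIso₁ (a := a) (b := b) (TwoCellClass.Hom₁.mk f) := by
  obtain ⟨g, h₁, h₂⟩ := h
  exact ⟨⟨g⟩, TwoCellClass.hom_ext _ h₁, TwoCellClass.hom_ext _ h₂⟩

end

/-! ### The 2-equivalences -/

theorem isEquivalence₁_unit (C : LCatLax.{u}) :
    IsEquivalence₁ (a := C) (b := Llax.obj (Rlax.obj C)) (ParObj.unit C.carrier) :=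
  ⟨ParObj.unitInverse C.carrier, ⟨ParObj.unitCompUnitInverseIso C.carrier⟩,
    ⟨eqToIso (ParObj.unitInverse_comp_unit C.carrier)⟩⟩

theorem isIso₁_counit (X : RCatLax.{u}) :
    IsIso₁ (a := Rlax.obj (Llax.obj X)) (b := X) (TotSplit.counit X.carrier) :=
  ⟨TotSplit.ofRestriction X.carrier, TotSplit.counit_comp_ofRestriction,
    TotSplit.ofRestriction_comp_counit⟩

/-- Since the unit is fully faithful and surjective on objects, only injectivity on objects can
fail. -/
theorem isIso₁_unit_iff (C : LCatLax.{u}) :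
    IsIso₁ (a := C) (b := Llax.obj (Rlax.obj C)) (ParObj.unit C.carrier) ↔
      Function.Injective (ParObj.unit C.carrier).obj := by
  constructor
  · rintro ⟨g, h, -⟩
    exact Function.LeftInverse.injective (g := g.obj) (fun U =>
      congrArg (fun F : LocalFunctor C.carrier C.carrier => F.obj U) h)
  · intro hinj
    exact ⟨ParObj.unitInverse C.carrier, ParObj.unit_comp_unitInverse hinj,
      ParObj.unitInverse_comp_unit C.carrier⟩

/-- The 2-adjunction between local categories and restriction categories, with the lax 2-cells. -/
def laxEquivalence : TwoEquivalence Rlax.{u} Llax.{u} where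
  unit :=
    { app := fun C => ParObj.unit C.carrier
      naturality := fun F => ParObj.comp_unit F
      naturality₂ := fun α => ParObj.unit_naturality₂ α }
  counit :=
    { app := fun X => TotSplit.counit X.carrier
      naturality := fun F => TotSplit.comp_counit F
      naturality₂ := fun α => TotSplit.counit_naturality₂ α }
  left_triangle _ := ParObj.map_unit_comp_counit
  right_triangle _ := TotSplit.unit_comp_map_counit
  unit_equivalence := isEquivalence₁_unit
  counit_equivalence X := (isIso₁_counit X).isEquivalence₁

/-- Invertible local natural transformations are total, so that the equivalences witnessed by lax
2-cells persist for total ones. -/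
theorem LocalTrans.isTotal_iso_hom {C D : Type u} [Category.{v} C] [LocalStructure C]
    [Category.{v} D] [LocalStructure D] {F G : LocalFunctor C D} (α : F ≅ G) :
    LocalTrans.IsTotal α.hom :=
  LocalTrans.isTotal_of_isIso _ (fun M => ⟨LocalTrans.app α.inv M,
    congrArg (fun β : F ⟶ F => LocalTrans.app β M) α.hom_inv_id,
    congrArg (fun β : G ⟶ G => LocalTrans.app β M) α.inv_hom_id⟩)

/-- The restriction of the 2-adjunction to total natural transformations. -/
def totalEquivalence : TwoEquivalence Rtot.{u} Ltot.{u} :=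
  TwoEquivalence.restrict (W := totalLTrans) (W' := totalRTrans) laxEquivalence
    (fun α hα => ParObj.map₂_isNatural α hα)
    (fun α hα => TotSplit.map₂_isTotal α hα)
    (fun C => TwoCellClass.isEquivalence₁_mk (isEquivalence₁_unit C.obj)
      (fun α => LocalTrans.isTotal_iso_hom α))
    (fun X => (TwoCellClass.isIso₁_mk (isIso₁_counit X.obj)).isEquivalence₁)

end Partiality

end

theorem mainTheorem1 :
    ∃ (e : Partiality.TwoEquivalence Partiality.Rlax.{u} Partiality.Llax.{u})
      (e' : Partiality.TwoEquivalence Partiality.Rtot.{u} Partiality.Ltot.{u}),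
      (∀ C : Partiality.LCat.{u}, (e'.unit.app C).hom = e.unit.app C.obj) ∧
      (∀ X : Partiality.RCat.{u}, (e'.counit.app X).hom = e.counit.app X.obj) ∧
      (∀ X : Partiality.RCatLax.{u}, Partiality.IsIso₁ (e.counit.app X)) ∧
      (∀ C : Partiality.LCatLax.{u}, Partiality.IsIso₁ (e.unit.app C) ↔
        ∀ (U V : C.carrier) (h : Partiality.LocalStructure.L U = Partiality.LocalStructure.L V)
          (φ : U ≅ V), φ.hom ≫ Partiality.LocalStructure.η V =
            Partiality.LocalStructure.η U ≫ eqToHom h → U = V) := by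
  refine ⟨Partiality.laxEquivalence, Partiality.totalEquivalence, fun _ => rfl, fun _ => rfl,
    Partiality.isIso₁_counit, fun C => (Partiality.isIso₁_unit_iff C).trans ?_⟩
  exact ⟨fun hinj U V h φ hφ => hinj (Partiality.ParObj.domain_eq_iff.2 ⟨h, φ, hφ⟩),
    fun H U V e => let ⟨h, φ, hφ⟩ := Partiality.ParObj.domain_eq_iff.1 e; H U V h φ hφ⟩
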